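/- **Setting.** Let $n\ge 2$ and let $\mathcal G=([n],\mathcal E)$ be a strongly connected directed graph (self-loops allowed), where $(i,j)\in\mathcal E$ means that agent $i$ can send to agent $j$. Let $\mathcal N_i^{\rm in}=\{j:(j,i)\in\mathcal E\}$, let $d_i$ be the out-degree of $i$, $d_{\max}=\max_i d_i$, $\phi$ the (directed) diameter, $D=\mathrm{diag}(d_1,\dots,d_n)$, $A_{ij}=1$ if $(j,i)\in\mathcal E$ and $A_{ij}=0$ otherwise, and $P=\frac12(I+AD^{-1})$. Let $\lambda_2(P)$ be the second largest modulus among the $n$ complex eigenvalues of $P$, counted with algebraic multiplicity. Let $f_1,\dots,f_n:\mathbb R^d\to\mathbb R$ be differentiable, and let $m_f,M_f>0$ be such that $(\nabla f_i(u)-\nabla f_i(v))^T(u-v)\ge m_f\|u-v\|^2$ and $\|\nabla f_i(u)-\nabla f_i(v)\|\le M_f\|u-v\|$ for all $i,u,v$. Suppose that $\sum_i f_i$ has a minimizer $\hat x$. Let $x^\star_i=\hat x$ and $y^\star_i=-\nabla f_i(\hat x)$ for $i\in[n]$, and let $\kappa=M_f/m_f$. IPD with full participation starts from $x^0=z^0=y^0=0$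 and initial weights $w_i^0(0)\in(0,d_{\max}^{-(2\phi+1)}]$, not all equal to $1$. For $k=0,1,\dots$, all agents $i$ set $$x_i^{k+1}=x_i^k-\eta\bigl(\nabla f_i(x_i^k)+y_i^k+\rho(x_i^k-z_i^k)\bigr),\qquad \xi_i^{k+1}(0)=x_i^{k+1};$$ for $b=0,\dots,B-1$, $$w_i^k(b+1)=\tfrac12\Bigl(w_i^k(b)+\tfrac1{d_i}\sum_{j\in\mathcal N_i^{\rm in}}w_j^k(b)\Bigr),\qquad \xi_i^{k+1}(b+1)=(1-d_iw_i^k(b))\,\xi_i^{k+1}(b)+\sum_{j\in\mathcal N_i^{\rm in}}w_j^k(b)\,\xi_j^{k+1}(b);$$ and then $$w_i^{k+1}(0)=w_i^k(B),\qquad z_i^{k+1}=\xi_i^{k+1}(B),\qquad y_i^{k+1}=y_i^k+\rho(x_i^{k+1}-z_i^{k+1}).$$ Write $v_\perp$ for the deviation of $v=(v_1,\dots,v_n)$ from its average, i.e. $(v_\perp)_i=v_i-\frac1n\sum_j v_j$. A number $\delta\in(0,1)$ is a *consensus constant* for a run of the algorithm if there are $\bar k>0$ and a sequence $\Delta^k=\mathcal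 O(\lambda_2(P)^k)$ such that for all $k\ge\bar k$ $$\|z_\perp^k\|^2\le\delta^{2B-1}\|x_\perp^k\|^2+\Delta^k\bigl(\|x^k-x^\star\|^2+\|x^\star\|^2\bigr).$$ **Statement.** There is a universal constant $c\in(0,1)$ such that for every graph and all initial weights as above the following hold. 1. There is a $\delta\in(0,1)$, depending only on the graph and the initial weights, that is a consensus constant for all runs (all $d$, all differentiable $f_i$ whose sum has a minimizer, convex or not, all $\eta,\rho>0$, all $B\ge1$). 2. Let $\eta=\frac{4}{15(M_f+m_f)}$ and $\rho=\frac{2}{87}\frac{M_fm_f}{M_f+m_f}$, let $\delta\in(0,1)$ be any consensus constant for the run, and let $B>\frac12+\frac{\ln(1000(\kappa+1))}{2\ln(1/\delta)}$. Then IPD with full participation converges linearly with rate $\lambda=\max\{1-\frac c\kappa,\lambda_2(P)\}$, that is, $0\le\lambda<1$ and $$\|x^k-x^\star\|^2+\|y^k-y^\star\|^2=\mathcal O(\lambda^k).$$ -/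

import Mathlib

open scoped Gradient

namespace IPD

noncomputable section

/-! ### The directed communication graph -/

section Graph

variable {n : ℕ} (G : Digraph (Fin n))

/-- There is a directed walk with exactly `l` edges from the first to the second vertex. -/
def HasWalk : ℕ → Fin n → Fin n → Prop
  | 0, i, j => i = j
  | l + 1, i, j => ∃ m, G.Adj i m ∧ HasWalk l m j

/-- Any vertex can be reached from any vertex along directed edges. -/
def StronglyConnected : Prop := ∀ i j, ∃ l, HasWalk G l i j

/-- Directed distance: the least length of a directed walk from `i` to `j`. -/
def dist (i j : Fin n) : ℕ := sInf {l | HasWalk G l i j}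

/-- The diameter `φ`: the largest directed distance. -/
def diameter : ℕ := Finset.univ.sup fun i => Finset.univ.sup fun j => dist G i j

open Classical in
/-- In-neighbours of `i`: the agents that can send a message to `i`. -/
def inNeighbors (i : Fin n) : Finset (Fin n) := Finset.univ.filter fun j => G.Adj j i

open Classical in
/-- Out-degree `d_i`. -/
def outDegree (i : Fin n) : ℕ := (Finset.univ.filter fun j => G.Adj i j).card

/-- Maximum out-degree `d_max`. -/
def maxOutDegree : ℕ := Finset.univ.sup fun i => outDegree G i

open Classical in
/-- Adjacency matrix: `A i j = 1` if `j` can send to `i`, and `0` otherwise. -/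
def adjacency : Matrix (Fin n) (Fin n) ℝ := Matrix.of fun i j => if G.Adj j i then 1 else 0

/-- `D = diag(d_1, …, d_n)`. -/
def degreeMatrix : Matrix (Fin n) (Fin n) ℝ := Matrix.diagonal fun i => (outDegree G i : ℝ)

/-- `P = (I + A D⁻¹) / 2`. -/
def transition : Matrix (Fin n) (Fin n) ℝ :=
  (1 / 2 : ℝ) • (1 + adjacency G * (degreeMatrix G)⁻¹)

/-- The moduli of the complex eigenvalues of `P`, repeated according to algebraic multiplicity,
in decreasing order. -/
def eigenvalueModuli : List ℝ :=
  (((transition G).map (algebraMap ℝ ℂ)).charpoly.roots.map fun z => ‖z‖).sort (· ≥ ·)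

/-- `λ₂(P)`: the second largest eigenvalue of `P`. The eigenvalues are complex in general, hence
ordered by modulus. (The list has `n` entries, so the default value is not used for `2 ≤ n`.) -/
def secondEigenvalue : ℝ := (eigenvalueModuli G).getD 1 0

/-- Admissible initial weights: `w_i ∈ (0, d_max ^ (-(2φ + 1))]`. -/
def AdmissibleWeights (w₀ : Fin n → ℝ) : Prop :=
  ∀ i, 0 < w₀ i ∧ w₀ i ≤ ((maxOutDegree G : ℝ) ^ (2 * diameter G + 1))⁻¹

end Graph

/-! ### The algorithm with full participation -/

/-- Local vectors are in `ℝ^d` with the Euclidean norm. -/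
abbrev Vec (d : ℕ) := EuclideanSpace ℝ (Fin d)

section Algorithm

variable {n d : ℕ} (G : Digraph (Fin n))

/-- One inner round: all agents update `w_i` and `ξ_i` simultaneously, from the old values. -/
def innerStep (s : (Fin n → ℝ) × (Fin n → Vec d)) : (Fin n → ℝ) × (Fin n → Vec d) :=
  (fun i => 1 / 2 * (s.1 i + 1 / (outDegree G i : ℝ) * ∑ j ∈ inNeighbors G i, s.1 j),
   fun i => (1 - (outDegree G i : ℝ) * s.1 i) • s.2 i + ∑ j ∈ inNeighbors G i, s.1 j • s.2 j)

/-- The variables kept between outer iterations; `w` is `w^k(0)`. -/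
@[ext] structure State (n d : ℕ) where
  x : Fin n → Vec d
  z : Fin n → Vec d
  y : Fin n → Vec d
  w : Fin n → ℝ

/-- The single gradient step of all agents. -/
def gradientStep (f : Fin n → Vec d → ℝ) (η ρ : ℝ) (s : State n d) : Fin n → Vec d :=
  fun i => s.x i - η • (∇ (f i) (s.x i) + s.y i + ρ • (s.x i - s.z i))

/-- One outer iteration in which all agents are active: gradient step, `B` rounds of averaging
started at the new `x`, dual ascent. -/
def step (f : Fin n → Vec d → ℝ) (η ρ : ℝ) (B : ℕ) (s : State n d) : State n d :=
  let x' := gradientStep f η ρ s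
  let r := (innerStep G)^[B] (s.w, x')
  { x := x'
    z := r.2
    y := fun i => s.y i + ρ • (x' i - r.2 i)
    w := r.1 }

/-- The iterates, from `x⁰ = z⁰ = y⁰ = 0` and initial weights `w₀`. -/
def iterates (w₀ : Fin n → ℝ) (f : Fin n → Vec d → ℝ) (η ρ : ℝ) (B : ℕ) : ℕ → State n d
  | 0 => { x := 0, z := 0, y := 0, w := w₀ }
  | k + 1 => step G f η ρ B (iterates w₀ f η ρ B k)

end Algorithm

/-! ### Objectives and optimality -/

section Problem

variable {n d : ℕ}

/-- Squared Euclidean norm of the concatenation of `v_1, …, v_n`. -/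
def sqNorm (v : Fin n → Vec d) : ℝ := ∑ i, ‖v i‖ ^ 2

/-- The deviation `v_⊥ = v - v̄` from the average. -/
def perp (v : Fin n → Vec d) : Fin n → Vec d := fun i => v i - (1 / (n : ℝ)) • ∑ j, v j

/-- Each `f_i` is differentiable, `m_f`-strongly convex, with `M_f`-Lipschitz gradient. -/
structure RegularObjectives (f : Fin n → Vec d → ℝ) (m_f M_f : ℝ) : Prop where
  m_pos : 0 < m_f
  M_pos : 0 < M_f
  differentiable : ∀ i, Differentiable ℝ (f i)
  strongly_convex : ∀ i u v, m_f * ‖u - v‖ ^ 2 ≤ inner ℝ (∇ (f i) u - ∇ (f i) v) (u - v)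
  lipschitz : ∀ i u v, ‖∇ (f i) u - ∇ (f i) v‖ ≤ M_f * ‖u - v‖

/-- `u` minimizes `f = ∑ i, f_i` over `ℝ^d`. -/
def IsMinimizer (f : Fin n → Vec d → ℝ) (u : Vec d) : Prop :=
  IsMinOn (fun v => ∑ i, f i v) Set.univ u

/-- The primal optimum `x^⋆ = (u, …, u)`, for a minimizer `u`. -/
def primalOpt (n : ℕ) (u : Vec d) : Fin n → Vec d := fun _ => u

/-- The dual optimum `y^⋆ = -∇F(x^⋆)`. -/
def dualOpt (f : Fin n → Vec d → ℝ) (u : Vec d) : Fin n → Vec d := fun i => -∇ (f i) u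

/-- `δ` is a consensus constant for a run of the algorithm: there are `k̄ > 0` and `Δ^k`, tending
to `0` geometrically with rate `λ₂(P)`, such that for all `k ≥ k̄`
`‖z^k_⊥‖² ≤ δ^(2B-1) ‖x^k_⊥‖² + Δ^k (‖x^k - x^⋆‖² + ‖x^⋆‖²)`. -/
def IsConsensusConstant (G : Digraph (Fin n)) (w₀ : Fin n → ℝ) (f : Fin n → Vec d → ℝ)
    (η ρ : ℝ) (B : ℕ) (u : Vec d) (δ : ℝ) : Prop :=
  ∃ kbar : ℕ, 0 < kbar ∧ ∃ Δ : ℕ → ℝ,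
    (Δ =O[Filter.atTop] fun k => secondEigenvalue G ^ k) ∧
    ∀ k ≥ kbar,
      sqNorm (perp (iterates G w₀ f η ρ B k).z) ≤
        δ ^ (2 * B - 1) * sqNorm (perp (iterates G w₀ f η ρ B k).x) +
          Δ k * (sqNorm ((iterates G w₀ f η ρ B k).x - primalOpt n u) + sqNorm (primalOpt n u))

/-- The squared distance `‖x^k - x^⋆‖² + ‖y^k - y^⋆‖²` to the primal-dual optimum. -/
def optError (G : Digraph (Fin n)) (w₀ : Fin n → ℝ) (f : Fin n → Vec d → ℝ)
    (η ρ : ℝ) (B : ℕ) (u : Vec d) (k : ℕ) : ℝ :=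
  sqNorm ((iterates G w₀ f η ρ B k).x - primalOpt n u) +
    sqNorm ((iterates G w₀ f η ρ B k).y - dualOpt f u)

/-- A sequence converges to zero linearly with rate `r`: `r ∈ [0, 1)` and `e k = O(r ^ k)`. -/
def ConvergesLinearly (e : ℕ → ℝ) (r : ℝ) : Prop :=
  0 ≤ r ∧ r < 1 ∧ e =O[Filter.atTop] fun k => r ^ k

end Problem

end

end IPD

namespace IPD

noncomputable section

/-! ### Convex smooth functions -/

section Smooth

variable {E : Type*} [NormedAddCommGroup E] [InnerProductSpace ℝ E] [CompleteSpace E]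

/-! Consensus. The scaled weights `d_i w_i` evolve by `P`, which is column stochastic and, thanks to
the summand `I/2` and strong connectivity, primitive. They therefore converge to a multiple of the
Perron vector. The limit weights `v` satisfy `d_i v_i = ∑ v_j` over in-neighbours, so one averaging
round with weights `v` has a doubly stochastic matrix. The bound on the initial weights gives `d_i
v_i < 1` (`limit_weights_lt_one`), hence nonnegative entries and a positive diagonal, and this
matrix strictly contracts disagreement (`IsAveraging.norm_mul_centering_lt_one`). By continuity all
late rounds contract with one factor `δ`, up to row-sum errors that decay with the weights
(`exists_round_contraction`). Deflating the Perron eigenvalue and applying Gelfand's formula bounds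
these errors by a multiple of `√λ₂ ^ t`. The consensus inequality involves squared norms, so the
loss of a square root is harmless (`exists_consensusConstant`).

Convergence. Averaging preserves sums, so `x - z` is the difference of the disagreements of `x` and
`z`, and `y - y⋆` always has zero sum. For the Lyapunov function `‖x - x⋆‖² + (η/ρ)‖y - y⋆‖²` the
cross terms between `y` and the other quantities cancel, except for the consensus error
(`lyapunov_identity`). Strong monotonicity with cocoercivity yields primal decrease; a leftover
`-η²‖y - y⋆‖²` yields dual decrease (`lyapunov_contraction`). The errors from `Δ^k` perturb this
contraction geometrically, and `isBigO_of_perturbed_contraction` absorbs them. -/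

lemma hasDerivAt_comp_line {f : E → ℝ} (hf : Differentiable ℝ f) (u w : E) (t : ℝ) :
    HasDerivAt (fun t : ℝ => f (u + t • w)) (inner ℝ (∇ f (u + t • w)) w) t := by
  have h1 : HasDerivAt (fun t : ℝ => u + t • w) w t := by
    simpa using ((hasDerivAt_id t).smul_const w).const_add u
  have h2 := (hf (u + t • w)).hasGradientAt.hasFDerivAt
  have h3 := h2.comp_hasDerivAt t h1
  rwa [InnerProductSpace.toDual_apply_apply] at h3

lemma le_of_monotone_gradient {f : E → ℝ} (hf : Differentiable ℝ f)
    (hmono : ∀ u v, 0 ≤ inner ℝ (∇ f u - ∇ f v) (u - v)) (u v : E) :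
    f u + inner ℝ (∇ f u) (v - u) ≤ f v := by
  set w := v - u with hw
  have hd : ∀ t : ℝ, HasDerivAt (fun t : ℝ => f (u + t • w) - t * inner ℝ (∇ f u) w)
      (inner ℝ (∇ f (u + t • w)) w - inner ℝ (∇ f u) w) t := fun t => by
    have h := (hasDerivAt_comp_line hf u w t).sub
      ((hasDerivAt_id t).mul_const (inner ℝ (∇ f u) w))
    rwa [one_mul] at h
  have hm : MonotoneOn (fun t : ℝ => f (u + t • w) - t * inner ℝ (∇ f u) w) (Set.Icc 0 1) := by
    refine monotoneOn_of_deriv_nonneg (convex_Icc 0 1)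
      (fun t _ => (hd t).continuousAt.continuousWithinAt)
      (fun t _ => (hd t).differentiableAt.differentiableWithinAt) fun t ht => ?_
    rw [interior_Icc] at ht
    rw [(hd t).deriv, ← inner_sub_left]
    have h := hmono (u + t • w) u
    rw [add_sub_cancel_left, inner_smul_right] at h
    exact nonneg_of_mul_nonneg_right h ht.1
  have h := hm (Set.left_mem_Icc.2 zero_le_one) (Set.right_mem_Icc.2 zero_le_one) zero_le_one
  simp only [zero_smul, add_zero, zero_mul, sub_zero, one_smul, one_mul] at h
  rw [hw, add_sub_cancel] at h
  linarith

/-- By Cauchy–Schwarz the derivative of the tangent gap at `u + t w` is at most `M t ‖w‖²`;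
integrating it is replaced by monotonicity of the difference with `M/2 ‖w‖² t²`. -/
lemma le_of_lipschitz_gradient {f : E → ℝ} {M : ℝ} (hf : Differentiable ℝ f)
    (hlip : ∀ u v, ‖∇ f u - ∇ f v‖ ≤ M * ‖u - v‖) (u v : E) :
    f v ≤ f u + inner ℝ (∇ f u) (v - u) + M / 2 * ‖v - u‖ ^ 2 := by
  set w := v - u with hw
  have hd : ∀ t : ℝ, HasDerivAt
      (fun t : ℝ => M / 2 * ‖w‖ ^ 2 * t ^ 2 - (f (u + t • w) - t * inner ℝ (∇ f u) w))
      (M * ‖w‖ ^ 2 * t - (inner ℝ (∇ f (u + t • w)) w - inner ℝ (∇ f u) w)) t := fun t => by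
    have h1 := ((hasDerivAt_id t).pow 2).const_mul (M / 2 * ‖w‖ ^ 2)
    have h2 := (hasDerivAt_comp_line hf u w t).sub
      ((hasDerivAt_id t).mul_const (inner ℝ (∇ f u) w))
    convert! h1.sub h2 using 1
    simp
    ring
  have hm : MonotoneOn
      (fun t : ℝ => M / 2 * ‖w‖ ^ 2 * t ^ 2 - (f (u + t • w) - t * inner ℝ (∇ f u) w))
      (Set.Icc 0 1) := by
    refine monotoneOn_of_deriv_nonneg (convex_Icc 0 1)
      (fun t _ => (hd t).continuousAt.continuousWithinAt)
      (fun t _ => (hd t).differentiableAt.differentiableWithinAt) fun t ht => ?_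
    rw [interior_Icc] at ht
    rw [(hd t).deriv, ← inner_sub_left]
    have h := hlip (u + t • w) u
    rw [add_sub_cancel_left, norm_smul, Real.norm_of_nonneg ht.1.le] at h
    have h3 := real_inner_le_norm (∇ f (u + t • w) - ∇ f u) w
    nlinarith [norm_nonneg w]
  have h := hm (Set.left_mem_Icc.2 zero_le_one) (Set.right_mem_Icc.2 zero_le_one) zero_le_one
  simp only [zero_smul, add_zero, zero_mul, sub_zero, one_smul, one_mul] at h
  rw [hw, add_sub_cancel] at h
  linarith

/-- The Baillon–Haddad inequality. -/
lemma gradient_cocoercive {f : E → ℝ} {M : ℝ} (hM : 0 < M) (hf : Differentiable ℝ f)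
    (hmono : ∀ u v, 0 ≤ inner ℝ (∇ f u - ∇ f v) (u - v))
    (hlip : ∀ u v, ‖∇ f u - ∇ f v‖ ≤ M * ‖u - v‖) (u v : E) :
    ‖∇ f u - ∇ f v‖ ^ 2 ≤ M * inner ℝ (∇ f u - ∇ f v) (u - v) := by
  have key : ∀ a b : E, f b + inner ℝ (∇ f b) (a - b) + 1 / (2 * M) * ‖∇ f a - ∇ f b‖ ^ 2
      ≤ f a := fun a b => by
    set h := ∇ f a - ∇ f b with hh
    -- The test point minimizes the quadratic upper model of `f - ⟨∇f b, ·⟩` at `a`. The tangent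
    -- bound from `b` and the upper model from `a` are compared there; adding the result to its
    -- mirror image gives cocoercivity.
    have h1 := le_of_monotone_gradient hf hmono b (a - (1 / M) • h)
    have h2 := le_of_lipschitz_gradient hf hlip a (a - (1 / M) • h)
    have e1 : a - (1 / M) • h - b = (a - b) - (1 / M) • h := by abel
    have e2 : a - (1 / M) • h - a = -((1 / M) • h) := by abel
    have e3 : ‖h‖ ^ 2 = inner ℝ (∇ f a) h - inner ℝ (∇ f b) h := by
      rw [← inner_sub_left, ← hh, real_inner_self_eq_norm_sq]
    rw [e1, inner_sub_right, inner_smul_right] at h1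
    rw [e2, inner_neg_right, inner_smul_right, norm_neg, norm_smul, mul_pow,
      Real.norm_of_nonneg (by positivity)] at h2
    have e4 : M / 2 * ((1 / M) ^ 2 * ‖h‖ ^ 2) = 1 / (2 * M) * ‖h‖ ^ 2 := by
      field_simp
    have e5 : 1 / M * ‖h‖ ^ 2 = 2 * (1 / (2 * M) * ‖h‖ ^ 2) := by
      field_simp
    rw [e4] at h2
    have e6 : 1 / M * ‖h‖ ^ 2 = 1 / M * inner ℝ (∇ f a) h - 1 / M * inner ℝ (∇ f b) h := by
      rw [e3]; ring
    linarith
  have h1 := key u v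
  have h2 := key v u
  rw [← norm_neg, neg_sub] at h2
  have e1 : inner ℝ (∇ f u) (v - u) = -inner ℝ (∇ f u) (u - v) := by
    rw [← inner_neg_right, neg_sub]
  rw [inner_sub_left]
  rw [e1] at h2
  have h3 : 1 / M * ‖∇ f u - ∇ f v‖ ^ 2 = 2 * (1 / (2 * M) * ‖∇ f u - ∇ f v‖ ^ 2) := by
    field_simp
  have h4 : 1 / M * ‖∇ f u - ∇ f v‖ ^ 2
      ≤ inner ℝ (∇ f u) (u - v) - inner ℝ (∇ f v) (u - v) := by linarith
  rw [one_div, inv_mul_le_iff₀ hM] at h4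
  exact h4

end Smooth

/-! ### One step of the perturbed primal-dual method -/

section OneStep

variable {E : Type*} [NormedAddCommGroup E] [InnerProductSpace ℝ E]

lemma norm_add_sq_le_two (a b : E) : ‖a + b‖ ^ 2 ≤ 2 * ‖a‖ ^ 2 + 2 * ‖b‖ ^ 2 := by
  have := parallelogram_law_with_norm ℝ a b
  nlinarith [norm_nonneg (a - b)]

lemma norm_sub_sq_le_two (a b : E) : ‖a - b‖ ^ 2 ≤ 2 * ‖a‖ ^ 2 + 2 * ‖b‖ ^ 2 := by
  simpa [sub_eq_add_neg] using norm_add_sq_le_two a (-b)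

/-- The exact change of the Lyapunov function in one step. -/
lemma lyapunov_identity {x y g u q' s' x' y' : E} {η ρ : ℝ} (hρ : ρ ≠ 0)
    (hx' : x' = x - η • (g + y + u)) (hy' : y' = y + ρ • (q' - s'))
    (hyq : inner ℝ y q' = inner ℝ y x') :
    ‖x'‖ ^ 2 + η / ρ * ‖y'‖ ^ 2 = ‖x‖ ^ 2 + η / ρ * ‖y‖ ^ 2 - 2 * η * inner ℝ g x
      - 2 * η * inner ℝ u x + η ^ 2 * ‖g + u‖ ^ 2 - η ^ 2 * ‖y‖ ^ 2 - 2 * η * inner ℝ y s'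
      + η * ρ * ‖q' - s'‖ ^ 2 := by
  have e0 : g + y + u = (g + u) + y := by abel
  have e1 : ‖x'‖ ^ 2 = ‖x‖ ^ 2 - 2 * η * (inner ℝ g x + inner ℝ u x + inner ℝ y x)
      + η ^ 2 * (‖g + u‖ ^ 2 + 2 * (inner ℝ y g + inner ℝ y u) + ‖y‖ ^ 2) := by
    rw [hx', e0, norm_sub_sq_real, norm_smul, mul_pow, Real.norm_eq_abs, sq_abs, inner_smul_right,
      norm_add_sq_real (g + u) y, inner_add_right, inner_add_right, inner_add_left,
      real_inner_comm g x, real_inner_comm u x, real_inner_comm y x, real_inner_comm y g,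
      real_inner_comm y u]
    ring
  have e2 : ‖y'‖ ^ 2 = ‖y‖ ^ 2 + 2 * ρ * (inner ℝ y x' - inner ℝ y s')
      + ρ ^ 2 * ‖q' - s'‖ ^ 2 := by
    rw [hy', norm_add_sq_real, norm_smul, mul_pow, Real.norm_eq_abs, sq_abs, inner_smul_right,
      inner_sub_right, hyq]
    ring
  have e3 : inner ℝ y x' = inner ℝ y x - η * (inner ℝ y g + inner ℝ y u + ‖y‖ ^ 2) := by
    rw [hx', e0, inner_sub_right, inner_smul_right, inner_add_right, inner_add_right,
      real_inner_self_eq_norm_sq]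
  rw [e2, e1, e3]
  field_simp
  ring

/-- Here `x, y` are deviations from the optimum, `g` is the gradient difference, and `q, s` are the
disagreements of the primal and averaged variables. With `τ = m/(M+m)`, the terms `-2η⟨g,x⟩` and
`-η²‖y‖²` pay for everything else: the former leaves a decrease of order `τ‖x‖²`, the latter one of
order `τ(η/ρ)‖y‖²`. The dual part is the tighter one and limits the rate. The second conclusion
controls the error `D'`, which later depends on `x'` itself. -/
lemma lyapunov_contraction {x y g q s q' s' x' y' : E} {m M η ρ ε D D' : ℝ}
    (hm : 0 < m) (hmM : m ≤ M) (hη : η = 4 / (15 * (M + m)))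
    (hρ : ρ = 2 / 87 * (M * m / (M + m))) (hε0 : 0 ≤ ε) (hε : ε ≤ m / (1000 * (M + m)))
    (hD : 0 ≤ D) (hD' : 0 ≤ D')
    (hx' : x' = x - η • (g + y + ρ • (q - s))) (hy' : y' = y + ρ • (q' - s'))
    (hyq : inner ℝ y q' = inner ℝ y x') (hq : ‖q‖ ^ 2 ≤ ‖x‖ ^ 2) (hq' : ‖q'‖ ^ 2 ≤ ‖x'‖ ^ 2)
    (hqx : 0 ≤ inner ℝ q x)
    (hs : ‖s‖ ^ 2 ≤ ε * ‖q‖ ^ 2 + D) (hs' : ‖s'‖ ^ 2 ≤ ε * ‖q'‖ ^ 2 + D')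
    (hg1 : m * ‖x‖ ^ 2 ≤ inner ℝ g x) (hg2 : ‖g‖ ^ 2 ≤ M * inner ℝ g x) :
    ‖x'‖ ^ 2 + η / ρ * ‖y'‖ ^ 2 ≤
      (1 - m / (1000 * (M + m))) * (‖x‖ ^ 2 + η / ρ * ‖y‖ ^ 2) + 100 * (D + D') ∧
    ‖x'‖ ^ 2 ≤ 4 * (‖x‖ ^ 2 + η / ρ * ‖y‖ ^ 2) + 4 * D := by
  have hM : 0 < M := hm.trans_le hmM
  have hL : 0 < M + m := by positivity
  set τ := m / (M + m) with hτ
  have hτ0 : 0 < τ := by positivity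
  have hτ1 : τ ≤ 1 / 2 := by rw [hτ, div_le_iff₀ hL]; linarith
  have hη0 : 0 < η := by rw [hη]; positivity
  have hρ0 : 0 < ρ := by rw [hρ]; positivity
  have hετ : ε ≤ τ / 1000 := by
    refine hε.trans (le_of_eq ?_); rw [hτ]; field_simp
  have hητ : η * m = 4 / 15 * τ := by rw [hη, hτ]; field_simp
  have hηM : η * M ≤ 4 / 15 := by
    rw [hη, div_mul_eq_mul_div, div_le_iff₀ (by positivity)]; linarith
  have ha : η * ρ = 8 / 1305 * (τ * (1 - τ)) := by
    rw [hη, hρ, hτ]; field_simp; ring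
  -- Since `0 < τ ≤ 1/2`, the product `τ(1-τ)` lies between `τ/2` and `τ`.
  have ha1 : η * ρ ≤ 8 / 1305 * τ := by nlinarith
  have ha2 : 4 / 1305 * τ ≤ η * ρ := by nlinarith
  have hrate : m / (1000 * (M + m)) = τ / 1000 := by rw [hτ]; field_simp
  have ha0 : 0 < η * ρ := by positivity
  set a := η * ρ with had
  have ha3 : a ≤ 1 / 300 := by linarith
  have hid := lyapunov_identity hρ0.ne' hx' hy' hyq
  set u := ρ • (q - s) with hu
  have hX0 : 0 ≤ ‖x‖ ^ 2 := by positivity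
  have hY0 : 0 ≤ ‖y‖ ^ 2 := by positivity
  have hS : ‖s‖ ^ 2 ≤ ε * ‖x‖ ^ 2 + D := by linarith [mul_le_mul_of_nonneg_left hq hε0]
  have hS' : ‖s'‖ ^ 2 ≤ ε * ‖x'‖ ^ 2 + D' := by
    linarith [mul_le_mul_of_nonneg_left hq' hε0]
  have hε1 : ε ≤ 1 / 1000 := by linarith
  -- the squared norm of the consensus correction
  have hU : η ^ 2 * ‖u‖ ^ 2 ≤ a ^ 2 * (3 * ‖x‖ ^ 2 + 2 * D) := by
    have h1 := norm_sub_sq_le_two q s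
    have h2 : η ^ 2 * ‖u‖ ^ 2 = a ^ 2 * ‖q - s‖ ^ 2 := by
      rw [hu, norm_smul, mul_pow, Real.norm_eq_abs, sq_abs, had]; ring
    rw [h2]
    refine mul_le_mul_of_nonneg_left ?_ (sq_nonneg a)
    linarith [mul_le_mul_of_nonneg_right hε1 hX0]
  have hU' : η ^ 2 * ‖u‖ ^ 2 ≤ 1 / 1000 * τ * ‖x‖ ^ 2 + D := by
    have h1 : a ^ 2 ≤ 1 / 10000 * τ := by
      have := mul_le_mul ha1 ha3 ha0.le (by positivity : (0 : ℝ) ≤ 8 / 1305 * τ)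
      rw [sq]; linarith
    have h2 : a ^ 2 * (3 * ‖x‖ ^ 2 + 2 * D) ≤ 1 / 10000 * τ * (3 * ‖x‖ ^ 2 + 2 * D) :=
      mul_le_mul_of_nonneg_right h1 (by positivity)
    have h3 := mul_nonneg hτ0.le hX0
    have h4 := mul_le_mul_of_nonneg_right hτ1 hD
    linarith
  have hgu : η ^ 2 * ‖g + u‖ ^ 2 ≤ 2 * (η ^ 2 * ‖g‖ ^ 2) + 2 * (η ^ 2 * ‖u‖ ^ 2) := by
    linarith [mul_le_mul_of_nonneg_left (norm_add_sq_le_two g u) (sq_nonneg η)]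
  have hgx : 0 ≤ inner ℝ g x := le_trans (by positivity) hg1
  have hG : η ^ 2 * ‖g‖ ^ 2 ≤ 4 / 15 * (η * inner ℝ g x) := by
    have h1 : η ^ 2 * ‖g‖ ^ 2 ≤ η ^ 2 * (M * inner ℝ g x) :=
      mul_le_mul_of_nonneg_left hg2 (sq_nonneg η)
    have h2 : (η * M) * (η * inner ℝ g x) ≤ 4 / 15 * (η * inner ℝ g x) :=
      mul_le_mul_of_nonneg_right hηM (by positivity)
    linarith
  have hGX : 4 / 15 * τ * ‖x‖ ^ 2 ≤ η * inner ℝ g x := by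
    rw [← hητ, mul_assoc]
    exact mul_le_mul_of_nonneg_left hg1 hη0.le
  -- Only the part with `s` can hurt: the part with `q` has the favourable sign by `hqx`.
  have hux : -(2 * η * inner ℝ u x) ≤ a * (2 * ‖x‖ ^ 2 + D) := by
    have h1 : -(2 * η * inner ℝ u x) = a * (2 * inner ℝ s x - 2 * inner ℝ q x) := by
      rw [hu, inner_smul_left, inner_sub_left, had]; simp; ring
    rw [h1]
    refine mul_le_mul_of_nonneg_left ?_ ha0.le
    have h2 : 2 * inner ℝ s x ≤ ‖s‖ ^ 2 + ‖x‖ ^ 2 := by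
      linarith [real_inner_le_norm s x, two_mul_le_add_sq ‖s‖ ‖x‖]
    linarith [mul_le_mul_of_nonneg_right hε1 hX0]
  -- Young's inequality, weighted to spend only a quarter of the dual decrease `η²‖y‖²`.
  have hys : -(2 * η * inner ℝ y s') ≤ 1 / 4 * (η ^ 2 * ‖y‖ ^ 2) + 4 * ‖s'‖ ^ 2 := by
    have h1 := neg_le_of_abs_le (abs_real_inner_le_norm y s')
    have h2 : -(2 * η * inner ℝ y s') ≤ 2 * η * (‖y‖ * ‖s'‖) := by
      linarith [mul_le_mul_of_nonneg_left h1 (by positivity : 0 ≤ 2 * η)]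
    linarith [sq_nonneg (1 / 2 * (η * ‖y‖) - 2 * ‖s'‖)]
  have hqs : a * ‖q' - s'‖ ^ 2 ≤ a * (3 * ‖x'‖ ^ 2 + 2 * D') := by
    refine mul_le_mul_of_nonneg_left ?_ ha0.le
    linarith [norm_sub_sq_le_two q' s', mul_le_mul_of_nonneg_right hε1 (sq_nonneg ‖x'‖),
      sq_nonneg ‖x'‖]
  have hX' : ‖x'‖ ^ 2 ≤ 2 * ‖x‖ ^ 2 + 4 * (η ^ 2 * ‖y‖ ^ 2) + 4 * (η ^ 2 * ‖u‖ ^ 2) := by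
    have e1 : x' = (x - η • g) - η • (y + u) := by rw [hx']; module
    have h1 := norm_sub_sq_le_two (x - η • g) (η • (y + u))
    have h2 : ‖η • (y + u)‖ ^ 2 ≤ η ^ 2 * (2 * ‖y‖ ^ 2 + 2 * ‖u‖ ^ 2) := by
      rw [norm_smul, mul_pow, Real.norm_eq_abs, sq_abs]
      exact mul_le_mul_of_nonneg_left (norm_add_sq_le_two y u) (sq_nonneg η)
    have h3 : ‖x - η • g‖ ^ 2 = ‖x‖ ^ 2 - 2 * (η * inner ℝ g x) + η ^ 2 * ‖g‖ ^ 2 := by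
      rw [norm_sub_sq_real, norm_smul, mul_pow, Real.norm_eq_abs, sq_abs, inner_smul_right,
        real_inner_comm]
    rw [← e1] at h1
    have h4 : 0 ≤ η * inner ℝ g x := by positivity
    linarith
  -- In units of the dual part of the Lyapunov function, the decrease `η²‖y‖²` is a contraction by
  -- the factor `ηρ`.
  have hηρ : η ^ 2 * ‖y‖ ^ 2 = a * (η / ρ * ‖y‖ ^ 2) := by
    rw [had]; field_simp
  set Z := η / ρ * ‖y‖ ^ 2 with hZ
  have hZ0 : 0 ≤ Z := by positivity
  rw [hηρ] at hX' hid hys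
  generalize hUg : η ^ 2 * ‖u‖ ^ 2 = U at *
  have hX'2 : ‖x'‖ ^ 2 ≤ 3 * ‖x‖ ^ 2 + 4 * (a * Z) + 4 * D := by
    linarith [mul_le_mul_of_nonneg_right hτ1 hX0]
  have haZ : 0 ≤ a * Z := by positivity
  constructor
  · rw [hid, hrate]
    have hS'2 : ‖s'‖ ^ 2 ≤ τ / 1000 * ‖x'‖ ^ 2 + D' := by
      linarith [mul_le_mul_of_nonneg_right hετ (sq_nonneg ‖x'‖)]
    have h5 : a * (3 * ‖x'‖ ^ 2 + 2 * D') ≤ 8 / 1305 * τ * (3 * ‖x'‖ ^ 2) + D' := by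
      linarith [mul_le_mul_of_nonneg_right ha1 (sq_nonneg ‖x'‖),
        mul_le_mul_of_nonneg_right ha3 hD']
    have h6 : a * (2 * ‖x‖ ^ 2 + D) ≤ 8 / 1305 * τ * (2 * ‖x‖ ^ 2) + D := by
      linarith [mul_le_mul_of_nonneg_right ha1 hX0, mul_le_mul_of_nonneg_right ha3 hD]
    have h7 : τ * ‖x'‖ ^ 2 ≤ 3 * (τ * ‖x‖ ^ 2) + 2 * (a * Z) + 2 * D := by
      have := mul_le_mul_of_nonneg_left hX'2 hτ0.le
      have h8 : τ * (a * Z) ≤ 1 / 2 * (a * Z) := mul_le_mul_of_nonneg_right hτ1 haZ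
      have h9 : τ * D ≤ 1 / 2 * D := mul_le_mul_of_nonneg_right hτ1 hD
      linarith
    have h10 : 4 / 1305 * (τ * Z) ≤ a * Z := by
      have := mul_le_mul_of_nonneg_right ha2 hZ0
      linarith
    have h11 : 0 ≤ τ * ‖x‖ ^ 2 := by positivity
    linarith
  · linarith [mul_le_mul_of_nonneg_right ha3 hZ0, mul_le_mul_of_nonneg_right ha3 hD]

end OneStep

/-! ### Scalar estimates -/

/-- The strict gap `a < r` is what lets a forcing term of the same rate `r` be absorbed without a
factor `k`. Once `C e_k ≤ (r-a)/2`, the bound `A r^k` propagates because `(a+r)/2 + (r-a)/2 = r`. -/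
lemma isBigO_of_perturbed_contraction {v e : ℕ → ℝ} {a r C : ℝ} (hv : ∀ k, 0 ≤ v k)
    (ha : 0 ≤ a) (har : a < r) (hr : r < 1) (hC : 0 ≤ C)
    (he : e =O[Filter.atTop] fun k => r ^ k)
    (hstep : ∀ᶠ k in Filter.atTop, v (k + 1) ≤ (a + C * e k) * v k + C * e k) :
    v =O[Filter.atTop] fun k => r ^ k := by
  have hr0 : 0 < r := ha.trans_lt har
  obtain ⟨c, hc0, hc⟩ := he.exists_pos
  have h0 : Filter.Tendsto (fun k : ℕ => C * c * r ^ k) Filter.atTop (nhds 0) := by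
    simpa using (tendsto_pow_atTop_nhds_zero_of_lt_one hr0.le hr).const_mul (C * c)
  have hh : 0 < (r - a) / 2 := by linarith
  obtain ⟨K, hK⟩ := Filter.eventually_atTop.1
    ((hc.bound.and hstep).and (h0.eventually_le_const hh))
  have hCc : 0 ≤ C * c := by positivity
  -- The first entry starts the induction at `K`; the second dominates the forcing term.
  set A := max (v K / r ^ K) (C * c / ((r - a) / 2)) with hA
  have hA1 : C * c ≤ A * ((r - a) / 2) := by
    rw [← div_le_iff₀ hh]; exact le_max_right _ _
  have key : ∀ k ≥ K, v k ≤ A * r ^ k := by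
    intro k hk
    induction k, hk using Nat.le_induction with
    | base => rw [← div_le_iff₀ (by positivity)]; exact le_max_left _ _
    | succ k hk ih =>
      obtain ⟨⟨h1, h2⟩, h3⟩ := hK k hk
      have h4 : e k ≤ c * r ^ k := by
        rw [Real.norm_eq_abs, Real.norm_of_nonneg (by positivity)] at h1
        exact (le_abs_self _).trans h1
      have h5 : C * e k ≤ C * c * r ^ k := by
        rw [mul_assoc]; exact mul_le_mul_of_nonneg_left h4 hC
      have h6 : (a + C * e k) * v k ≤ ((a + r) / 2) * (A * r ^ k) :=
        mul_le_mul (by linarith) ih (hv k) (by linarith)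
      have h7 : C * c * r ^ k ≤ A * ((r - a) / 2) * r ^ k :=
        mul_le_mul_of_nonneg_right hA1 (by positivity)
      calc v (k + 1) ≤ _ := h2
        _ ≤ ((a + r) / 2) * (A * r ^ k) + A * ((r - a) / 2) * r ^ k := by linarith
        _ = A * r ^ (k + 1) := by rw [pow_succ]; ring
  refine Asymptotics.IsBigO.of_bound A ?_
  filter_upwards [Filter.eventually_ge_atTop K] with k hk
  rw [Real.norm_of_nonneg (hv k), Real.norm_of_nonneg (by positivity)]
  exact key k hk

lemma pow_le_of_log_lt {δ κ : ℝ} {B : ℕ} (hδ0 : 0 < δ) (hδ1 : δ < 1) (hκ : 0 < κ)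
    (hB : (B : ℝ) > 1 / 2 + Real.log (1000 * (κ + 1)) / (2 * Real.log (1 / δ))) :
    δ ^ (2 * B - 1) ≤ 1 / (1000 * (κ + 1)) := by
  have hl : 0 < Real.log (1 / δ) := Real.log_pos (by rw [lt_div_iff₀ hδ0]; linarith)
  have hk : 0 < Real.log (1000 * (κ + 1)) := Real.log_pos (by linarith)
  -- The logarithmic bound forces `B > 0`, so the natural subtraction in `2 * B - 1` does not
  -- truncate.
  have hB1 : 1 ≤ 2 * B := by
    have h : (0 : ℝ) < B := lt_trans (by positivity) hB
    have : 0 < B := by exact_mod_cast h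
    omega
  have h1 : Real.log (1000 * (κ + 1)) < (2 * B - 1) * Real.log (1 / δ) := by
    have h2 : Real.log (1000 * (κ + 1)) / (2 * Real.log (1 / δ)) < B - 1 / 2 := by linarith
    rw [div_lt_iff₀ (by positivity)] at h2
    linarith
  have h3 : Real.log (1000 * (κ + 1)) < Real.log ((1 / δ) ^ (2 * B - 1)) := by
    rw [Real.log_pow, Nat.cast_sub hB1]; push_cast; exact h1
  have h4 := (Real.log_lt_log_iff (by positivity) (by positivity)).1 h3
  rw [one_div, inv_pow] at h4
  rw [one_div]
  exact le_inv_of_le_inv₀ (by positivity) h4.le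

/-! ### Sums over agents -/

section Sums

variable {n d : ℕ}

/-- The concatenation of the local vectors, in the Euclidean product space. -/
abbrev stack (v : Fin n → Vec d) : PiLp 2 (fun _ : Fin n => Vec d) := WithLp.toLp 2 v

lemma norm_stack_sq (v : Fin n → Vec d) : ‖stack v‖ ^ 2 = sqNorm v := by
  rw [PiLp.norm_sq_eq_of_L2]; rfl

lemma inner_stack (v w : Fin n → Vec d) :
    inner ℝ (stack v) (stack w) = ∑ i, inner ℝ (v i) (w i) := by
  rw [PiLp.inner_apply]

lemma sqNorm_nonneg (v : Fin n → Vec d) : 0 ≤ sqNorm v :=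
  Finset.sum_nonneg fun _ _ => sq_nonneg _

lemma perp_sub (v w : Fin n → Vec d) : perp (v - w) = perp v - perp w := by
  ext1 i
  simp only [perp, Pi.sub_apply, Finset.sum_sub_distrib, smul_sub]
  abel

lemma perp_const (hn : n ≠ 0) (u : Vec d) : perp (fun _ : Fin n => u) = 0 := by
  have : (n : ℝ) ≠ 0 := by exact_mod_cast hn
  ext1 i
  simp [perp, ← Nat.cast_smul_eq_nsmul ℝ, smul_smul, this]

lemma sum_perp (hn : n ≠ 0) (v : Fin n → Vec d) : ∑ i, perp v i = 0 := by
  have : (n : ℝ) ≠ 0 := by exact_mod_cast hn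
  simp [perp, Finset.sum_sub_distrib, ← Nat.cast_smul_eq_nsmul ℝ, smul_smul, this]

lemma perp_eq_self {v : Fin n → Vec d} (h : ∑ i, v i = 0) : perp v = v := by
  ext1 i
  simp [perp, h]

/-- A vector with zero sum does not see averages. -/
lemma inner_stack_perp {y : Fin n → Vec d} (hy : ∑ i, y i = 0) (v : Fin n → Vec d) :
    inner ℝ (stack y) (stack (perp v)) = inner ℝ (stack y) (stack v) := by
  rw [inner_stack, inner_stack]
  simp only [perp, inner_sub_right, Finset.sum_sub_distrib]
  rw [← sum_inner, hy, inner_zero_left, sub_zero]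

lemma inner_perp_self (hn : n ≠ 0) (v : Fin n → Vec d) :
    inner ℝ (stack (perp v)) (stack v) = sqNorm (perp v) := by
  rw [← inner_stack_perp (sum_perp hn v), real_inner_self_eq_norm_sq, norm_stack_sq]

lemma sqNorm_perp_le (hn : n ≠ 0) (v : Fin n → Vec d) : sqNorm (perp v) ≤ sqNorm v := by
  have h1 := inner_perp_self hn v
  have h2 := real_inner_le_norm (stack (perp v)) (stack v)
  have h3 := two_mul_le_add_sq ‖stack (perp v)‖ ‖stack v‖
  rw [norm_stack_sq, norm_stack_sq] at h3
  linarith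

lemma sum_gradient_eq_zero {f : Fin n → Vec d → ℝ} (hf : ∀ i, Differentiable ℝ (f i)) {u : Vec d}
    (hu : IsMinimizer f u) : ∑ i, ∇ (f i) u = 0 := by
  have h1 : fderiv ℝ (fun v => ∑ i, f i v) u = 0 :=
    (hu.isLocalMin Filter.univ_mem).fderiv_eq_zero
  rw [fderiv_fun_sum fun i _ => hf i u] at h1
  simp only [gradient, ← map_sum, h1, map_zero]

end Sums

/-! ### Invariants of the iteration -/

section Invariants

variable {n d : ℕ} (G : Digraph (Fin n))

lemma sum_inNeighbors {V : Type*} [AddCommMonoid V] (g : Fin n → V) :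
    ∑ i, ∑ j ∈ inNeighbors G i, g j = ∑ j, outDegree G j • g j := by
  classical
  simp only [inNeighbors, outDegree, Finset.sum_filter]
  rw [Finset.sum_comm]
  refine Finset.sum_congr rfl fun j _ => ?_
  rw [← Finset.sum_filter, Finset.sum_const]

lemma sum_innerStep (s : (Fin n → ℝ) × (Fin n → Vec d)) :
    ∑ i, (innerStep G s).2 i = ∑ i, s.2 i := by
  simp only [innerStep, Finset.sum_add_distrib, sum_inNeighbors, sub_smul, one_smul,
    Finset.sum_sub_distrib, ← Nat.cast_smul_eq_nsmul ℝ, smul_smul]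
  abel

lemma sum_innerStep_iterate (B : ℕ) (s : (Fin n → ℝ) × (Fin n → Vec d)) :
    ∑ i, ((innerStep G)^[B] s).2 i = ∑ i, s.2 i := by
  induction B with
  | zero => rfl
  | succ B ih => rw [Function.iterate_succ_apply', sum_innerStep, ih]

variable (w₀ : Fin n → ℝ) (f : Fin n → Vec d → ℝ) (η ρ : ℝ) (B : ℕ)

lemma sum_iterates_z (k : ℕ) :
    ∑ i, (iterates G w₀ f η ρ B k).z i = ∑ i, (iterates G w₀ f η ρ B k).x i := by
  cases k with
  | zero => rfl
  | succ k => exact sum_innerStep_iterate G B _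

/-- The averages of `x` and `z` agree and cancel. Hence both the primal correction and the dual
update see disagreements only. -/
lemma sub_z_eq_perp (k : ℕ) :
    (iterates G w₀ f η ρ B k).x - (iterates G w₀ f η ρ B k).z =
      perp (iterates G w₀ f η ρ B k).x - perp (iterates G w₀ f η ρ B k).z := by
  ext1 i
  simp only [perp, Pi.sub_apply, sum_iterates_z]
  abel

lemma iterates_succ_x (k : ℕ) : (iterates G w₀ f η ρ B (k + 1)).x =
    gradientStep f η ρ (iterates G w₀ f η ρ B k) := rfl

lemma iterates_succ_y (k : ℕ) : (iterates G w₀ f η ρ B (k + 1)).y =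
    (iterates G w₀ f η ρ B k).y + ρ • (perp (iterates G w₀ f η ρ B (k + 1)).x -
      perp (iterates G w₀ f η ρ B (k + 1)).z) := by
  rw [← sub_z_eq_perp]; rfl

lemma sum_iterates_y (hn : n ≠ 0) (k : ℕ) : ∑ i, (iterates G w₀ f η ρ B k).y i = 0 := by
  induction k with
  | zero => simp [iterates]
  | succ k ih =>
    rw [iterates_succ_y]
    simp [Finset.sum_add_distrib, ih, ← Finset.smul_sum, sum_perp hn]

end Invariants

/-! ### Linear convergence -/

section Convergence

variable {n d : ℕ} {G : Digraph (Fin n)} {w₀ : Fin n → ℝ} {f : Fin n → Vec d → ℝ}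

/-- Both constants are tested on a unit vector, which exists only in positive dimension. -/
lemma RegularObjectives.m_le_M {m_f M_f : ℝ} (h : RegularObjectives f m_f M_f) (hn : n ≠ 0)
    (hd : d ≠ 0) : m_f ≤ M_f := by
  have i : Fin n := ⟨0, Nat.pos_of_ne_zero hn⟩
  set e : Vec d := EuclideanSpace.single ⟨0, Nat.pos_of_ne_zero hd⟩ 1
  have he : ‖e - 0‖ = 1 := by simp [e]
  have h1 := h.strongly_convex i e 0
  have h2 := h.lipschitz i e 0
  have h3 := real_inner_le_norm (∇ (f i) e - ∇ (f i) 0) (e - 0)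
  rw [he] at h1 h2 h3
  linarith

/-- One outer iteration contracts the Lyapunov function up to the consensus errors. -/
lemma optError_step (hn : n ≠ 0) {m M η ρ ε D D' : ℝ} {B : ℕ} (hf : RegularObjectives f m M)
    (hmM : m ≤ M) {u : Vec d} (hu : IsMinimizer f u) (hη : η = 4 / (15 * (M + m)))
    (hρ : ρ = 2 / 87 * (M * m / (M + m))) (hε0 : 0 ≤ ε) (hε : ε ≤ m / (1000 * (M + m)))
    (hD : 0 ≤ D) (hD' : 0 ≤ D') (k : ℕ)
    (hs : sqNorm (perp (iterates G w₀ f η ρ B k).z)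
      ≤ ε * sqNorm (perp (iterates G w₀ f η ρ B k).x) + D)
    (hs' : sqNorm (perp (iterates G w₀ f η ρ B (k + 1)).z)
      ≤ ε * sqNorm (perp (iterates G w₀ f η ρ B (k + 1)).x) + D') :
    let X := fun k => sqNorm ((iterates G w₀ f η ρ B k).x - primalOpt n u)
    let V := fun k => X k + η / ρ * sqNorm ((iterates G w₀ f η ρ B k).y - dualOpt f u)
    V (k + 1) ≤ (1 - m / (1000 * (M + m))) * V k + 100 * (D + D') ∧
      X (k + 1) ≤ 4 * V k + 4 * D := by
  intro X V
  set s := iterates G w₀ f η ρ B k with hsdef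
  set s' := iterates G w₀ f η ρ B (k + 1) with hsdef'
  have hpx : ∀ x : Fin n → Vec d, perp (x - primalOpt n u) = perp x := fun x => by
    rw [perp_sub, show primalOpt n u = fun _ => u from rfl, perp_const hn, sub_zero]
  have hsy : ∑ i, (s.y - dualOpt f u) i = 0 := by
    have h1 := sum_iterates_y G w₀ f η ρ B hn k
    have h2 := sum_gradient_eq_zero hf.differentiable hu
    simp only [Pi.sub_apply, dualOpt, Finset.sum_sub_distrib, Finset.sum_neg_distrib, h2]
    rw [← hsdef] at h1
    rw [h1]; simp
  set g : Fin n → Vec d := fun i => ∇ (f i) (s.x i) - ∇ (f i) u with hg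
  have hx' : stack (s'.x - primalOpt n u) = stack (s.x - primalOpt n u)
      - η • (stack g + stack (s.y - dualOpt f u) + ρ • (stack (perp s.x) - stack (perp s.z))) := by
    rw [hsdef', iterates_succ_x, ← hsdef]
    rw [← WithLp.toLp_sub 2 (perp s.x), hsdef, ← sub_z_eq_perp, ← hsdef]
    ext1 i
    simp only [gradientStep, primalOpt, dualOpt, g, PiLp.sub_apply, PiLp.add_apply,
      PiLp.smul_apply, Pi.sub_apply]
    module
  have hy' : stack (s'.y - dualOpt f u) = stack (s.y - dualOpt f u)
      + ρ • (stack (perp s'.x) - stack (perp s'.z)) := by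
    rw [hsdef', iterates_succ_y, ← hsdef, ← hsdef']
    ext1 i
    simp only [PiLp.sub_apply, PiLp.add_apply, PiLp.smul_apply, Pi.sub_apply, Pi.add_apply,
      Pi.smul_apply]
    abel
  have hyq : inner ℝ (stack (s.y - dualOpt f u)) (stack (perp s'.x))
      = inner ℝ (stack (s.y - dualOpt f u)) (stack (s'.x - primalOpt n u)) := by
    rw [← hpx s'.x, inner_stack_perp hsy]
  have hg1 : m * ‖stack (s.x - primalOpt n u)‖ ^ 2
      ≤ inner ℝ (stack g) (stack (s.x - primalOpt n u)) := by
    rw [norm_stack_sq, inner_stack, sqNorm, Finset.mul_sum]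
    exact Finset.sum_le_sum fun i _ => hf.strongly_convex i _ _
  have hg2 : ‖stack g‖ ^ 2 ≤ M * inner ℝ (stack g) (stack (s.x - primalOpt n u)) := by
    rw [norm_stack_sq, inner_stack, sqNorm, Finset.mul_sum]
    refine Finset.sum_le_sum fun i _ => gradient_cocoercive hf.M_pos (hf.differentiable i)
      (fun a b => le_trans ?_ (hf.strongly_convex i a b)) (hf.lipschitz i) _ _
    have := hf.m_pos
    positivity
  have hqx : 0 ≤ inner ℝ (stack (perp s.x)) (stack (s.x - primalOpt n u)) := by
    rw [← hpx s.x, inner_perp_self hn]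
    exact sqNorm_nonneg _
  have hq : ∀ x : Fin n → Vec d,
      ‖stack (perp x)‖ ^ 2 ≤ ‖stack (x - primalOpt n u)‖ ^ 2 := fun x => by
    rw [norm_stack_sq, norm_stack_sq, ← hpx x]
    exact sqNorm_perp_le hn _
  rw [← norm_stack_sq, ← norm_stack_sq] at hs hs'
  have := lyapunov_contraction hf.m_pos hmM hη hρ hε0 hε hD hD' hx' hy' hyq (hq _) (hq _) hqx
    hs hs' hg1 hg2
  simpa only [norm_stack_sq] using this

/-- Treated apart because the regularity conditions are vacuous here and do not give `m ≤ M`. -/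
lemma convergesLinearly_of_dim_zero (hd : d = 0) (η ρ : ℝ) (B : ℕ) (u : Vec d) {r : ℝ}
    (hr0 : 0 ≤ r) (hr1 : r < 1) : ConvergesLinearly (optError G w₀ f η ρ B u) r := by
  subst hd
  refine ⟨hr0, hr1, ?_⟩
  have : optError G w₀ f η ρ B u = fun _ => 0 := by
    ext k
    simp [optError, sqNorm, Subsingleton.elim _ (0 : Vec 0)]
  rw [this]
  exact Asymptotics.isBigO_zero _ _

theorem convergesLinearly_of_consensus (hn : n ≠ 0) (hl0 : 0 ≤ secondEigenvalue G)
    (hl1 : secondEigenvalue G < 1) {m M κ η ρ δ : ℝ} {B : ℕ} {u : Vec d}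
    (hf : RegularObjectives f m M) (hu : IsMinimizer f u) (hκ : κ = M / m)
    (hη : η = 4 / (15 * (M + m))) (hρ : ρ = 2 / 87 * (M * m / (M + m)))
    (hδ0 : 0 < δ) (hδ1 : δ < 1) (hc : IsConsensusConstant G w₀ f η ρ B u δ)
    (hB : (B : ℝ) > 1 / 2 + Real.log (1000 * (κ + 1)) / (2 * Real.log (1 / δ))) :
    ConvergesLinearly (optError G w₀ f η ρ B u)
      (max (1 - (1 / 4000) / κ) (secondEigenvalue G)) := by
  have hm := hf.m_pos
  have hM := hf.M_pos
  have hκ0 : 0 < κ := by rw [hκ]; positivity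
  have hr0 := hl0.trans (le_max_right (1 - (1 / 4000) / κ) _)
  have hr1 : max (1 - (1 / 4000) / κ) (secondEigenvalue G) < 1 :=
    max_lt (by have : 0 < (1 / 4000) / κ := by positivity
               linarith) hl1
  rcases eq_or_ne d 0 with hd | hd
  · exact convergesLinearly_of_dim_zero hd _ _ _ _ hr0 hr1
  have hmM := hf.m_le_M hn hd
  refine ⟨hr0, hr1, ?_⟩
  set r := max (1 - (1 / 4000) / κ) (secondEigenvalue G) with hr
  have hη0 : 0 < η := by rw [hη]; positivity
  have hρ0 : 0 < ρ := by rw [hρ]; positivity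
  have hε : δ ^ (2 * B - 1) ≤ m / (1000 * (M + m)) := by
    refine (pow_le_of_log_lt hδ0 hδ1 hκ0 hB).trans (le_of_eq ?_)
    rw [hκ]; field_simp
  obtain ⟨K, -, Δ, hΔ, hK⟩ := hc
  set X := fun k => sqNorm ((iterates G w₀ f η ρ B k).x - primalOpt n u) with hX
  set Y := fun k => sqNorm ((iterates G w₀ f η ρ B k).y - dualOpt f u) with hY
  set U := sqNorm (primalOpt n u) with hU
  have hU0 : 0 ≤ U := sqNorm_nonneg _
  have hX0 : ∀ k, 0 ≤ X k := fun k => sqNorm_nonneg _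
  have hY0 : ∀ k, 0 ≤ Y k := fun k => sqNorm_nonneg _
  have hV0 : ∀ k, 0 ≤ X k + η / ρ * Y k := fun k =>
    add_nonneg (hX0 k) (mul_nonneg (by positivity) (hY0 k))
  have hΔr : Δ =O[Filter.atTop] fun k => r ^ k := by
    refine hΔ.trans (Asymptotics.IsBigO.of_bound 1 (Filter.Eventually.of_forall fun k => ?_))
    rw [one_mul, Real.norm_of_nonneg (by positivity), Real.norm_of_nonneg (by positivity)]
    exact pow_le_pow_left₀ hl0 (le_max_right _ _) k
  have hΔr' : (fun k => Δ (k + 1)) =O[Filter.atTop] fun k => r ^ k := by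
    refine (hΔr.comp_tendsto (Filter.tendsto_add_atTop_nat 1)).trans
      (Asymptotics.IsBigO.of_bound 1 (Filter.Eventually.of_forall fun k => ?_))
    simp only [Function.comp]
    rw [one_mul, Real.norm_of_nonneg (by positivity), Real.norm_of_nonneg (by positivity)]
    exact pow_le_pow_of_le_one hr0 hr1.le (Nat.le_succ k)
  have hE : (fun k => |Δ k| + |Δ (k + 1)|) =O[Filter.atTop] fun k => r ^ k :=
    hΔr.abs_left.add hΔr'.abs_left
  have hΔ0 : Filter.Tendsto Δ Filter.atTop (nhds 0) :=
    hΔr.trans_tendsto (tendsto_pow_atTop_nhds_zero_of_lt_one hr0 hr1)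
  have hΔ1 : ∀ᶠ k in Filter.atTop, |Δ k| ≤ 1 := by
    have := hΔ0.abs
    rw [abs_zero] at this
    exact this.eventually_le_const one_pos
  have hτ : m / (1000 * (M + m)) ≤ 1 := by
    rw [div_le_one (by positivity)]; nlinarith
  -- From `m ≤ M` one gets `1000(M+m) ≤ 2000M < 4000M`; the slack supplies the strict gap for the
  -- perturbation argument.
  have har : 1 - m / (1000 * (M + m)) < r := by
    refine lt_of_lt_of_le ?_ (le_max_left _ _)
    have h1 : 1 / 4000 / κ = m / (4000 * M) := by rw [hκ]; field_simp
    have h2 : m / (4000 * M) < m / (1000 * (M + m)) :=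
      div_lt_div_of_pos_left hm (by positivity) (by linarith)
    linarith
  have hmain : (fun k => X k + η / ρ * Y k) =O[Filter.atTop] fun k => r ^ k := by
    -- The error at `k+1` involves `X (k+1) + U ≤ 8V + 5U`, once `|Δ k| ≤ 1`; multiplying by `100`
    -- gives the constant.
    refine isBigO_of_perturbed_contraction (C := 800 + 500 * U) hV0 (by linarith) har hr1
      (by positivity) hE ?_
    filter_upwards [hΔ1, Filter.eventually_ge_atTop K] with k hk1 hkK
    have hcons : ∀ j ≥ K, sqNorm (perp (iterates G w₀ f η ρ B j).z) ≤
        δ ^ (2 * B - 1) * sqNorm (perp (iterates G w₀ f η ρ B j).x) + |Δ j| * (X j + U) :=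
      fun j hj => (hK j hj).trans (by
        have := mul_le_mul_of_nonneg_right (le_abs_self (Δ j)) (add_nonneg (hX0 j) hU0)
        linarith)
    obtain ⟨h1, h2⟩ := optError_step hn hf hmM hu hη hρ (by positivity) hε
      (mul_nonneg (abs_nonneg (Δ k)) (add_nonneg (hX0 k) hU0))
      (mul_nonneg (abs_nonneg (Δ (k + 1))) (add_nonneg (hX0 (k + 1)) hU0)) k
      (hcons k hkK) (hcons (k + 1) (by omega))
    change X (k + 1) + η / ρ * Y (k + 1) ≤ _ at h1
    change X (k + 1) ≤ 4 * (X k + η / ρ * Y k) + _ at h2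
    change _ ≤ _ * (X k + η / ρ * Y k) + _ at h1
    have hXV : X k ≤ X k + η / ρ * Y k := le_add_of_nonneg_right (by have := hY0 k; positivity)
    have hV := hV0 k
    set V := X k + η / ρ * Y k
    have hk0 := abs_nonneg (Δ k)
    have hk0' := abs_nonneg (Δ (k + 1))
    set e := |Δ k|
    set e' := |Δ (k + 1)|
    have h3 : e * (X k + U) ≤ e * (V + U) := by gcongr
    have h4 : e * (V + U) ≤ V + U := mul_le_of_le_one_left (by positivity) hk1
    have h5 : e' * (X (k + 1) + U) ≤ e' * (8 * V + 5 * U) :=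
      mul_le_mul_of_nonneg_left (by linarith) hk0'
    have h6 : 0 ≤ (e + e') * V * U := by positivity
    have h7 : 0 ≤ e * V := by positivity
    have h8 : 0 ≤ e * U := by positivity
    linarith
  refine Asymptotics.IsBigO.trans ?_ hmain
  refine Asymptotics.IsBigO.of_bound (1 + ρ / η) (Filter.Eventually.of_forall fun k => ?_)
  change ‖X k + Y k‖ ≤ _
  rw [Real.norm_of_nonneg (add_nonneg (hX0 k) (hY0 k)), Real.norm_of_nonneg (hV0 k)]
  have h1 : (1 + ρ / η) * (X k + η / ρ * Y k) = X k + Y k + ρ / η * X k + η / ρ * Y k := by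
    field_simp; ring
  rw [h1]
  have h2 := hX0 k
  have h3 := hY0 k
  have : 0 ≤ ρ / η * X k := by positivity
  have : 0 ≤ η / ρ * Y k := by positivity
  linarith

end Convergence

/-! ### Column-stochastic matrices with a positive power -/

section Stochastic

variable {n : ℕ}

/-- Doeblin's contraction: a column-stochastic matrix with entries at least `ε` contracts the
`ℓ¹` norm of vectors with zero sum. -/
lemma sum_norm_smul_le {E : Type*} [NormedAddCommGroup E] [NormedSpace ℝ E]
    {M : Matrix (Fin n) (Fin n) ℝ} (hM : M ∈ Matrix.colStochastic ℝ (Fin n)) {ε : ℝ}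
    (hε : ∀ i j, ε ≤ M i j) {v : Fin n → E} (hv : ∑ j, v j = 0) :
    ∑ i, ‖∑ j, M i j • v j‖ ≤ (1 - n * ε) * ∑ j, ‖v j‖ := by
  have h1 : ∀ i, ‖∑ j, M i j • v j‖ ≤ ∑ j, (M i j - ε) * ‖v j‖ := fun i => by
    have h2 : ∑ j, M i j • v j = ∑ j, (M i j - ε) • v j := by
      simp only [sub_smul, Finset.sum_sub_distrib, ← Finset.smul_sum, hv, smul_zero, sub_zero]
    rw [h2]
    refine (norm_sum_le _ _).trans (Finset.sum_le_sum fun j _ => ?_)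
    rw [norm_smul, Real.norm_of_nonneg (sub_nonneg.2 (hε i j))]
  refine (Finset.sum_le_sum fun i _ => h1 i).trans (le_of_eq ?_)
  rw [Finset.sum_comm, Finset.mul_sum]
  refine Finset.sum_congr rfl fun j _ => ?_
  rw [← Finset.sum_mul, Finset.sum_sub_distrib, Matrix.sum_col_of_mem_colStochastic hM]
  simp

lemma exists_pos_le_entries {M : Matrix (Fin n) (Fin n) ℝ} (hM : ∀ i j, 0 < M i j) :
    ∃ ε > 0, ∀ i j, ε ≤ M i j := by
  rcases isEmpty_or_nonempty (Fin n) with h | h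
  · exact ⟨1, one_pos, fun i => isEmptyElim i⟩
  · obtain ⟨p, hp⟩ := Finite.exists_min fun p : Fin n × Fin n => M p.1 p.2
    exact ⟨_, hM p.1 p.2, fun i j => hp (i, j)⟩

/-- A column-stochastic matrix is primitive when some power has positive entries only. -/
structure IsPrimitiveStochastic (P : Matrix (Fin n) (Fin n) ℝ) (N : ℕ) : Prop where
  mem : P ∈ Matrix.colStochastic ℝ (Fin n)
  pow_pos : ∀ i j, 0 < (P ^ N) i j

variable {P : Matrix (Fin n) (Fin n) ℝ} {N : ℕ}

lemma pow_mulVec_of_eigenvector {R : Type*} [CommRing R] {A : Matrix (Fin n) (Fin n) R}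
    {v : Fin n → R} {c : R} (h : A.mulVec v = c • v) (t : ℕ) : (A ^ t).mulVec v = c ^ t • v := by
  induction t with
  | zero => simp
  | succ t ih => rw [pow_succ, ← Matrix.mulVec_mulVec, h, Matrix.mulVec_smul, ih, smul_smul,
      pow_succ, mul_comm]

/-- Eigenvectors with zero sum belong to eigenvalues inside the unit disc. -/
lemma IsPrimitiveStochastic.norm_eigenvalue_lt_one (hP : IsPrimitiveStochastic P N) (hn : n ≠ 0)
    {𝕜 : Type*} [RCLike 𝕜] {v : Fin n → 𝕜} {c : 𝕜} (hv : v ≠ 0) (hsum : ∑ i, v i = 0)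
    (h : (P.map (algebraMap ℝ 𝕜)).mulVec v = c • v) : ‖c‖ < 1 := by
  obtain ⟨ε, hε0, hε⟩ := exists_pos_le_entries hP.pow_pos
  -- The positive power `P^N` multiplies the eigenvector by `c^N` and shrinks its `ℓ¹` norm by at
  -- least `1 - nε < 1`.
  have h1 := sum_norm_smul_le (pow_mem hP.mem N) hε hsum
  have h2 : ∀ i, ∑ j, (P ^ N) i j • v j = c ^ N * v i := fun i => by
    have h3 := congrFun (pow_mulVec_of_eigenvector h N) i
    have h4 : (P.map (algebraMap ℝ 𝕜)) ^ N = (P ^ N).map (algebraMap ℝ 𝕜) :=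
      (map_pow (algebraMap ℝ 𝕜).mapMatrix P N).symm
    rw [h4] at h3
    simpa [Matrix.mulVec, dotProduct, Algebra.smul_def] using h3
  simp only [h2, norm_mul, norm_pow, ← Finset.mul_sum] at h1
  have h5 : 0 < ∑ i, ‖v i‖ := by
    obtain ⟨i, hi⟩ := Function.ne_iff.1 hv
    exact Finset.sum_pos' (fun _ _ => norm_nonneg _) ⟨i, Finset.mem_univ _, norm_pos_iff.2 hi⟩
  have h6 : ‖c‖ ^ N ≤ 1 - n * ε := le_of_mul_le_mul_right h1 h5
  have h7 : 0 < n * ε := by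
    have : (0 : ℝ) < n := by exact_mod_cast Nat.pos_of_ne_zero hn
    positivity
  by_contra! hc
  linarith [one_le_pow₀ hc (n := N)]

lemma IsPrimitiveStochastic.eq_zero_of_fixed (hP : IsPrimitiveStochastic P N) (hn : n ≠ 0)
    {v : Fin n → ℝ} (hsum : ∑ i, v i = 0) (h : P.mulVec v = v) : v = 0 := by
  by_contra hv
  have := hP.norm_eigenvalue_lt_one hn (𝕜 := ℝ) (c := 1) hv hsum (by
    rw [one_smul]; exact h)
  simp at this

/-- Existence of the Perron vector. -/
lemma IsPrimitiveStochastic.exists_fixed (hP : IsPrimitiveStochastic P N) (hn : n ≠ 0) :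
    ∃ p : Fin n → ℝ, (∀ i, 0 < p i) ∧ ∑ i, p i = 1 ∧ P.mulVec p = p := by
  -- Column sums one make the all-ones row a left eigenvector, so `1` is an eigenvalue and a right
  -- eigenvector exists.
  have hdet : (P - 1).det = 0 := by
    rw [← Matrix.exists_vecMul_eq_zero_iff]
    refine ⟨1, fun h => ?_, ?_⟩
    · exact one_ne_zero (congrFun h ⟨0, Nat.pos_of_ne_zero hn⟩)
    · rw [Matrix.vecMul_sub, Matrix.one_vecMul_of_mem_colStochastic hP.mem, Matrix.vecMul_one,
        sub_self]
  obtain ⟨v, hv, hPv⟩ := Matrix.exists_mulVec_eq_zero_iff.2 hdet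
  rw [Matrix.sub_mulVec, Matrix.one_mulVec, sub_eq_zero] at hPv
  have hS : ∑ i, v i ≠ 0 := fun h => hv (hP.eq_zero_of_fixed hn h hPv)
  set p : Fin n → ℝ := (∑ i, v i)⁻¹ • v with hp
  have hp1 : ∑ i, p i = 1 := by simp [hp, ← Finset.mul_sum, hS]
  have hpP : P.mulVec p = p := by rw [hp, Matrix.mulVec_smul, hPv]
  -- the absolute value of a fixed vector is fixed
  set a : Fin n → ℝ := fun i => |p i| with ha
  have hle : ∀ i, a i ≤ P.mulVec a i := fun i => by
    have h1 : a i = |P.mulVec p i| := by rw [hpP]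
    rw [h1]
    refine (Finset.abs_sum_le_sum_abs (fun j => P i j * p j) Finset.univ).trans (Finset.sum_le_sum fun j _ => ?_)
    rw [abs_mul, abs_of_nonneg (Matrix.nonneg_of_mem_colStochastic hP.mem)]
  have hsum : ∑ i, P.mulVec a i = ∑ i, a i := Matrix.sum_mulVec_of_mem_colStochastic hP.mem
  -- The inequality `a ≤ P a` holds entrywise and both sides have the same sum, so it is an
  -- equality.
  have haP : P.mulVec a = a := by
    ext i
    exact ((Finset.sum_eq_sum_iff_of_le fun i _ => hle i).1 hsum.symm i (Finset.mem_univ i)).symm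
  have hae : a = (∑ i, a i) • p := by
    rw [← sub_eq_zero]
    refine hP.eq_zero_of_fixed hn ?_ ?_
    · simp [Finset.sum_sub_distrib, ← Finset.mul_sum, hp1]
    · rw [Matrix.mulVec_sub, Matrix.mulVec_smul, haP, hpP]
  have ha0 : 0 < ∑ i, a i := by
    have : |∑ i, p i| ≤ ∑ i, a i := Finset.abs_sum_le_sum_abs _ _
    rw [hp1, abs_one] at this
    linarith
  have hp0 : ∀ i, 0 ≤ p i := fun i => by
    have h1 : a i = (∑ i, a i) * p i := congrFun hae i
    exact nonneg_of_mul_nonneg_right (h1 ▸ abs_nonneg (p i)) ha0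
  refine ⟨p, fun i => ?_, hp1, hpP⟩
  -- Strict positivity comes from applying the positive matrix `P^N` to a nonzero nonnegative
  -- vector.
  have h1 : p i = ∑ j, (P ^ N) i j * p j := by
    have := congrFun (pow_mulVec_of_eigenvector (c := (1 : ℝ)) (by rw [one_smul]; exact hpP) N) i
    rw [one_pow, one_smul] at this
    exact this.symm
  rw [h1]
  have : ∃ j, p j ≠ 0 := by
    by_contra! h
    simp [h] at hp1
  obtain ⟨j, hj⟩ := this
  exact Finset.sum_pos' (fun j _ => mul_nonneg (hP.pow_pos i j).le (hp0 j))
    ⟨j, Finset.mem_univ _, mul_pos (hP.pow_pos i j) (lt_of_le_of_ne (hp0 j) hj.symm)⟩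

end Stochastic

/-! ### Deflation of the Perron eigenvalue -/

section Deflation

variable {n : ℕ} {R : Type*} [CommRing R]

/-- The rank one matrix all of whose columns are `p`. -/
def columns (p : Fin n → R) : Matrix (Fin n) (Fin n) R := Matrix.of fun i _ => p i

lemma mul_columns {P : Matrix (Fin n) (Fin n) R} {p : Fin n → R} (h : P.mulVec p = p) :
    P * columns p = columns p := by
  ext i j
  rw [Matrix.mul_apply]
  exact congrFun h i

lemma columns_mul {P : Matrix (Fin n) (Fin n) R} {p : Fin n → R} (h : ∀ j, ∑ i, P i j = 1) :
    columns p * P = columns p := by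
  ext i j
  simp [Matrix.mul_apply, columns, ← Finset.mul_sum, h]

lemma columns_mulVec (p v : Fin n → R) : (columns p).mulVec v = (∑ i, v i) • p := by
  ext i
  simp [Matrix.mulVec, dotProduct, columns, ← Finset.mul_sum, mul_comm]

lemma sum_columns {p : Fin n → R} (h : ∑ i, p i = 1) (j : Fin n) : ∑ i, columns p i j = 1 := h

lemma det_one_add_smul_columns {p : Fin n → R} (h : ∑ i, p i = 1) (c : R) :
    (1 + c • columns p).det = 1 + c := by
  have h1 := Matrix.det_one_add_replicateCol_mul_replicateRow (ι := Unit) (c • p) (1 : Fin n → R)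
  rw [dotProduct_smul] at h1
  simp only [dotProduct, Pi.one_apply, one_mul, h, smul_eq_mul, mul_one] at h1
  rw [← h1]
  congr 2
  ext i j
  simp [columns, Matrix.mul_apply]

/-- Subtracting the Perron projection replaces the eigenvalue `1` by `0`. -/
lemma charpoly_sub_columns {P : Matrix (Fin n) (Fin n) R} {p : Fin n → R}
    (hP : P.mulVec p = p) (hp : ∑ i, p i = 1) :
    (P - columns p).charpoly * (Polynomial.X - 1) = P.charpoly * Polynomial.X := by
  set x : Polynomial R := Polynomial.X
  set Q := Polynomial.C.mapMatrix P with hQ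
  set J := Polynomial.C.mapMatrix (columns p) with hJ
  have hJc : J = columns fun i => Polynomial.C (p i) := rfl
  have hps : ∑ i, Polynomial.C (p i) = 1 := by rw [← map_sum, hp, map_one]
  have hQJ : Q * J = J := by rw [hQ, hJ, ← map_mul, mul_columns hP]
  have hJJ : J * J = J := by rw [hJ, ← map_mul, columns_mul (sum_columns hp)]
  -- As `QJ = J² = J`, both sides expand alike, using `x(x-2) + 1 = (x-1)²`. The rank-one factors
  -- have determinants `x - 1` and `x`.
  have key : (x • (1 : Matrix (Fin n) (Fin n) (Polynomial R)) - (Q - J)) * (1 + (x - 2) • J)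
      = (x • (1 : Matrix (Fin n) (Fin n) (Polynomial R)) - Q) * (1 + (x - 1) • J) := by
    simp only [mul_add, sub_mul, smul_mul_assoc, one_mul, mul_one, mul_smul_comm, hQJ, hJJ]
    module
  have hdet := congrArg Matrix.det key
  rw [Matrix.det_mul, Matrix.det_mul, hJc, det_one_add_smul_columns hps,
    det_one_add_smul_columns hps, ← hJc] at hdet
  have e1 : (P - columns p).charpoly
      = (x • (1 : Matrix (Fin n) (Fin n) (Polynomial R)) - (Q - J)).det := by
    rw [Matrix.charpoly, Matrix.charmatrix, map_sub, Matrix.scalar_apply, Matrix.smul_one_eq_diagonal]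
  have e2 : P.charpoly = (x • (1 : Matrix (Fin n) (Fin n) (Polynomial R)) - Q).det := by
    rw [Matrix.charpoly, Matrix.charmatrix, Matrix.scalar_apply, Matrix.smul_one_eq_diagonal]
  rw [e1, e2, show x - 1 = 1 + (x - 2) by ring, hdet]
  ring

/-- The Perron projection `J` satisfies `PJ = JP = J² = J`, so mixed terms collapse. Exponent zero
must be excluded, since there the projection is not subtracted. -/
lemma sub_columns_pow {P : Matrix (Fin n) (Fin n) R} {p : Fin n → R}
    (hP : P.mulVec p = p) (hp : ∑ i, p i = 1) (hcol : ∀ j, ∑ i, P i j = 1) (t : ℕ) :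
    (P - columns p) ^ (t + 1) = P ^ (t + 1) - columns p := by
  induction t with
  | zero => simp
  | succ t ih =>
    have h1 : P ^ (t + 1) * columns p = columns p := by
      apply mul_columns
      have := pow_mulVec_of_eigenvector (c := (1 : R)) (by rw [one_smul]; exact hP) (t + 1)
      rwa [one_pow, one_smul] at this
    rw [pow_succ, ih, sub_mul, mul_sub, mul_sub, h1, columns_mul hcol,
      columns_mul (sum_columns hp), ← pow_succ]
    abel

end Deflation

/-! ### Powers of a matrix with small eigenvalues -/

section Decay

open scoped Matrix.Norms.L2Operator

variable {n : ℕ}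

lemma norm_entry_le_norm {𝕜 : Type*} [RCLike 𝕜] (A : Matrix (Fin n) (Fin n) 𝕜) (i j : Fin n) :
    ‖A i j‖ ≤ ‖A‖ := by
  have h := Matrix.l2_opNorm_mulVec A (EuclideanSpace.single j 1)
  rw [PiLp.norm_single, norm_one, mul_one] at h
  refine le_trans ?_ h
  refine le_trans (le_of_eq ?_) (PiLp.norm_apply_le _ i)
  simp

/-- Over `ℂ` the characteristic polynomial is `X^n`; Cayley–Hamilton finishes. -/
lemma pow_eq_zero_of_roots_eq_zero {A : Matrix (Fin n) (Fin n) ℂ}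
    (h : ∀ c ∈ A.charpoly.roots, c = 0) : A ^ n = 0 := by
  have h1 := (IsAlgClosed.splits A.charpoly).eq_prod_roots_of_monic A.charpoly_monic
  have h2 : A.charpoly.roots = Multiset.replicate n 0 := by
    rw [Multiset.eq_replicate]
    refine ⟨?_, h⟩
    rw [Polynomial.splits_iff_card_roots.1 (IsAlgClosed.splits A.charpoly),
      Matrix.charpoly_natDegree_eq_dim, Fintype.card_fin]
  rw [h2] at h1
  have h3 := A.aeval_self_charpoly
  rw [h1] at h3
  simpa using h3

/-- Jordan blocks may prevent a bound by a constant times `l^t`, so Gelfand's formula is used with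
the strictly larger rate `√l`. At `l = 0` there is no such room, and nilpotency replaces it. -/
lemma norm_pow_entry_le {A : Matrix (Fin n) (Fin n) ℂ} {l : ℝ} (hl0 : 0 ≤ l) (hl1 : l < 1)
    (h : ∀ c ∈ A.charpoly.roots, ‖c‖ ≤ l) :
    ∃ t₀ : ℕ, ∀ t ≥ t₀, ∀ i j, ‖(A ^ t) i j‖ ≤ √l ^ t := by
  rcases hl0.eq_or_lt with rfl | hl0
  · refine ⟨n, fun t ht i j => ?_⟩
    have h1 : A ^ n = 0 := pow_eq_zero_of_roots_eq_zero fun c hc => norm_le_zero_iff.1 (h c hc)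
    rw [← Nat.add_sub_of_le ht, pow_add, h1, zero_mul]
    simp only [Matrix.zero_apply, norm_zero]
    positivity
  · have hlt : l < √l := by
      rw [Real.lt_sqrt hl0.le]; nlinarith
    have hs : spectralRadius ℂ A < ENNReal.ofReal √l := by
      refine lt_of_le_of_lt (b := ENNReal.ofReal l) ?_
        ((ENNReal.ofReal_lt_ofReal_iff (hl0.trans hlt)).2 hlt)
      refine iSup₂_le fun c hc => ?_
      have hc' := h c ((Polynomial.mem_roots A.charpoly_monic.ne_zero).2
        (Matrix.mem_spectrum_iff_isRoot_charpoly.1 hc))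
      rw [← enorm_eq_nnnorm, ← ofReal_norm]
      exact ENNReal.ofReal_le_ofReal hc'
    have ht := (spectrum.pow_nnnorm_pow_one_div_tendsto_nhds_spectralRadius A).eventually_lt_const hs
    obtain ⟨t₀, ht₀⟩ := Filter.eventually_atTop.1 ht
    refine ⟨max t₀ 1, fun t htt i j => (norm_entry_le_norm _ i j).trans ?_⟩
    have ht1 : (0 : ℝ) < t := by
      have : 1 ≤ t := (le_max_right _ _).trans htt
      exact_mod_cast this
    have h1 := ht₀ t ((le_max_left _ _).trans htt)
    rw [one_div, ENNReal.rpow_inv_lt_iff ht1, ENNReal.rpow_natCast,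
      ← ENNReal.ofReal_pow (Real.sqrt_nonneg l), ← enorm_eq_nnnorm, ← ofReal_norm] at h1
    exact (ENNReal.ofReal_le_ofReal_iff (by positivity)).1 h1.le

end Decay

/-! ### The transition matrix of a strongly connected graph -/

section Transition

variable {n : ℕ} {G : Digraph (Fin n)}

lemma StronglyConnected.outDegree_pos (hG : StronglyConnected G) (hn : 2 ≤ n) (i : Fin n) :
    0 < outDegree G i := by
  have : Nontrivial (Fin n) := Fin.nontrivial_iff_two_le.2 hn
  obtain ⟨j, hj⟩ := exists_ne i
  obtain ⟨l, hl⟩ := hG i j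
  cases l with
  | zero => exact absurd hl.symm hj
  | succ l =>
    obtain ⟨k, hk, -⟩ := hl
    exact Finset.card_pos.2 ⟨k, by simpa using hk⟩

lemma StronglyConnected.outDegree_cast_pos (hG : StronglyConnected G) (hn : 2 ≤ n) (i : Fin n) :
    (0 : ℝ) < outDegree G i := by exact_mod_cast hG.outDegree_pos hn i

lemma sum_adjacency_mul (g : Fin n → ℝ) (i : Fin n) :
    ∑ j, adjacency G i j * g j = ∑ j ∈ inNeighbors G i, g j := by
  classical
  simp [adjacency, inNeighbors, Finset.sum_filter]

lemma sum_adjacency (j : Fin n) : ∑ i, adjacency G i j = outDegree G j := by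
  classical
  simp [adjacency, outDegree]

lemma adjacency_nonneg (i j : Fin n) : 0 ≤ adjacency G i j := by
  classical
  simp only [adjacency, Matrix.of_apply]; split_ifs <;> norm_num

lemma adjacency_eq_one {i j : Fin n} (h : G.Adj j i) : adjacency G i j = 1 := by
  classical
  simp [adjacency, h]

lemma transition_apply (hG : StronglyConnected G) (hn : 2 ≤ n) (i j : Fin n) :
    transition G i j =
      1 / 2 * ((1 : Matrix (Fin n) (Fin n) ℝ) i j + adjacency G i j / outDegree G j) := by
  have h : (degreeMatrix G)⁻¹ = Matrix.diagonal fun i => ((outDegree G i : ℝ))⁻¹ := by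
    refine Matrix.inv_eq_right_inv ?_
    rw [degreeMatrix, Matrix.diagonal_mul_diagonal, ← Matrix.diagonal_one]
    congr 1
    ext i
    exact mul_inv_cancel₀ (hG.outDegree_cast_pos hn i).ne'
  rw [transition, h, Matrix.smul_apply, Matrix.add_apply, Matrix.mul_diagonal, smul_eq_mul,
    div_eq_mul_inv (adjacency G i j)]

lemma transition_mem (hG : StronglyConnected G) (hn : 2 ≤ n) :
    transition G ∈ Matrix.colStochastic ℝ (Fin n) := by
  rw [Matrix.mem_colStochastic_iff_sum]
  refine ⟨fun i j => ?_, fun j => ?_⟩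
  · rw [transition_apply hG hn]
    have := adjacency_nonneg (G := G) i j
    have h1 : (0 : ℝ) ≤ (1 : Matrix (Fin n) (Fin n) ℝ) i j := by
      rw [Matrix.one_apply]; split_ifs <;> norm_num
    positivity
  · simp only [transition_apply hG hn, ← Finset.mul_sum, Finset.sum_add_distrib, ← Finset.sum_div,
      sum_adjacency, div_self (hG.outDegree_cast_pos hn j).ne', Matrix.one_apply]
    simp
    norm_num

lemma transition_diag_pos (hG : StronglyConnected G) (hn : 2 ≤ n) (i : Fin n) :
    0 < transition G i i := by
  rw [transition_apply hG hn, Matrix.one_apply_eq]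
  have := adjacency_nonneg (G := G) i i
  positivity

lemma transition_adj_pos (hG : StronglyConnected G) (hn : 2 ≤ n) {i j : Fin n} (h : G.Adj j i) :
    0 < transition G i j := by
  rw [transition_apply hG hn, adjacency_eq_one h]
  have h0 := hG.outDegree_cast_pos hn j
  have h1 : (0 : ℝ) ≤ (1 : Matrix (Fin n) (Fin n) ℝ) i j := by
    rw [Matrix.one_apply]; split_ifs <;> norm_num
  positivity

lemma transition_pow_nonneg (hG : StronglyConnected G) (hn : 2 ≤ n) (t : ℕ) (i j : Fin n) :
    0 ≤ (transition G ^ t) i j :=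
  Matrix.nonneg_of_mem_colStochastic (pow_mem (transition_mem hG hn) t)

lemma transition_pow_pos_of_walk (hG : StronglyConnected G) (hn : 2 ≤ n) {l : ℕ} {i j : Fin n}
    (h : HasWalk G l i j) : 0 < (transition G ^ l) j i := by
  induction l generalizing i with
  | zero => obtain rfl : i = j := h; simp
  | succ l ih =>
    obtain ⟨m, him, hm⟩ := h
    rw [pow_succ, Matrix.mul_apply]
    exact Finset.sum_pos' (fun k _ => mul_nonneg (transition_pow_nonneg hG hn _ _ _)
        (Matrix.nonneg_of_mem_colStochastic (transition_mem hG hn)))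
      ⟨m, Finset.mem_univ _, mul_pos (ih hm) (transition_adj_pos hG hn him)⟩

lemma transition_pow_pos_mono (hG : StronglyConnected G) (hn : 2 ≤ n) {l N : ℕ} (hl : l ≤ N)
    {i j : Fin n} (h : 0 < (transition G ^ l) i j) : 0 < (transition G ^ N) i j := by
  induction N, hl using Nat.le_induction with
  | base => exact h
  | succ N _ ih =>
    rw [pow_succ, Matrix.mul_apply]
    exact Finset.sum_pos' (fun k _ => mul_nonneg (transition_pow_nonneg hG hn _ _ _)
        (Matrix.nonneg_of_mem_colStochastic (transition_mem hG hn)))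
      ⟨j, Finset.mem_univ _, mul_pos ih (transition_diag_pos hG hn j)⟩

/-- Positive diagonal entries let a walk idle, so the longest of finitely many chosen walks provides
one exponent for all pairs. -/
lemma exists_isPrimitiveStochastic (hG : StronglyConnected G) (hn : 2 ≤ n) :
    ∃ N, IsPrimitiveStochastic (transition G) N := by
  choose l hl using id hG
  refine ⟨Finset.univ.sup fun i => Finset.univ.sup fun j => l i j, transition_mem hG hn,
    fun i j => transition_pow_pos_mono hG hn ?_ (transition_pow_pos_of_walk hG hn (hl j i))⟩
  exact (Finset.le_sup (f := fun i' => l j i') (Finset.mem_univ i)).trans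
    (Finset.le_sup (f := fun j' => Finset.univ.sup fun i' => l j' i') (Finset.mem_univ j))

end Transition

/-! ### The second eigenvalue -/

section SecondEigenvalue

lemma sort_getD_zero_spec (s : Multiset ℝ) :
    (∀ b ∈ s, b ≤ (s.sort (· ≥ ·)).getD 0 0) ∧
      ((s.sort (· ≥ ·)).getD 0 0 ∈ s ∨ (s.sort (· ≥ ·)).getD 0 0 = 0) := by
  have hmem : ∀ b, b ∈ s.sort (· ≥ ·) ↔ b ∈ s := fun b => Multiset.mem_sort (r := (· ≥ ·))
  have hsort := Multiset.pairwise_sort s (· ≥ ·)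
  cases h : s.sort (· ≥ ·) with
  | nil =>
    refine ⟨fun b hb => ?_, Or.inr rfl⟩
    rw [← hmem, h] at hb
    simp at hb
  | cons a l =>
    rw [h] at hsort hmem
    refine ⟨fun b hb => ?_, Or.inl ((hmem a).1 (by simp))⟩
    rw [← hmem, List.mem_cons] at hb
    rcases hb with rfl | hb
    · exact le_refl _
    · exact (List.pairwise_cons.1 hsort).1 b hb

variable {n : ℕ} {G : Digraph (Fin n)}

/-- The transition matrix with its Perron eigenvalue deflated, over the complex numbers. -/
def deflated (G : Digraph (Fin n)) (p : Fin n → ℝ) : Matrix (Fin n) (Fin n) ℂ :=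
  (transition G - columns p).map (algebraMap ℝ ℂ)

lemma deflated_eq (p : Fin n → ℝ) : deflated G p =
    (transition G).map (algebraMap ℝ ℂ) - columns fun i => (p i : ℂ) := by
  ext i j
  simp [deflated, columns]

/-- The columns of the deflated matrix sum to zero, so an eigenvector for a nonzero eigenvalue has
zero sum. The Perron projection then kills it, making it an eigenvector of `P`, to which Doeblin's
contraction applies. -/
lemma norm_lt_one_of_mem_roots_deflated (hG : StronglyConnected G) (hn : 2 ≤ n) {p : Fin n → ℝ}
    (hp1 : ∑ i, p i = 1) {c : ℂ} (hc : c ∈ (deflated G p).charpoly.roots) : ‖c‖ < 1 := by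
  obtain ⟨N, hN⟩ := exists_isPrimitiveStochastic hG hn
  rcases eq_or_ne c 0 with rfl | hc0
  · simp
  have h1 : (deflated G p).charpoly.eval c = 0 := (Polynomial.mem_roots'.1 hc).2
  rw [Matrix.eval_charpoly, ← Matrix.exists_mulVec_eq_zero_iff] at h1
  obtain ⟨v, hv, hTv⟩ := h1
  rw [Matrix.sub_mulVec, sub_eq_zero, Matrix.scalar_apply, ← Matrix.smul_one_eq_diagonal,
    Matrix.smul_mulVec, Matrix.one_mulVec] at hTv
  have hcol : ∀ j, ∑ i, deflated G p i j = 0 := fun j => by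
    have h2 := Matrix.sum_col_of_mem_colStochastic (transition_mem hG hn) j
    have h3 : ∑ i, (transition G - columns p) i j = 0 := by
      simp only [Matrix.sub_apply, Finset.sum_sub_distrib, h2, sum_columns hp1, sub_self]
    have h4 := congrArg (algebraMap ℝ ℂ) h3
    rwa [map_sum, map_zero] at h4
  have hsum : ∑ i, v i = 0 := by
    have h2 : ∑ i, c * v i = ∑ i, ∑ j, deflated G p i j * v j :=
      Finset.sum_congr rfl fun i _ => congrFun hTv i
    rw [Finset.sum_comm] at h2
    simp only [← Finset.sum_mul, hcol, zero_mul, Finset.sum_const_zero] at h2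
    rw [← Finset.mul_sum] at h2
    exact (mul_eq_zero.1 h2).resolve_left hc0
  refine hN.norm_eigenvalue_lt_one (by omega) hv hsum ?_
  rw [deflated_eq, Matrix.sub_mulVec, columns_mulVec, hsum, zero_smul, sub_zero] at hTv
  exact hTv.symm

/-- Deflation replaces one root `1` by `0` and leaves the multiset `R` of the others. These lie
inside the unit disc, so `1` heads the sorted list and entry one of that list is the largest modulus
in `R`. -/
lemma secondEigenvalue_spec (hG : StronglyConnected G) (hn : 2 ≤ n) {p : Fin n → ℝ}
    (hp1 : ∑ i, p i = 1) (hp : (transition G).mulVec p = p) :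
    0 ≤ secondEigenvalue G ∧ secondEigenvalue G < 1 ∧
      ∀ c ∈ (deflated G p).charpoly.roots, ‖c‖ ≤ secondEigenvalue G := by
  set Pc := (transition G).map (algebraMap ℝ ℂ) with hPc
  have hPcp : Pc.mulVec (fun i => (p i : ℂ)) = fun i => (p i : ℂ) := by
    ext i
    have h1 := congrArg (algebraMap ℝ ℂ) (congrFun hp i)
    simpa [Matrix.mulVec, dotProduct, hPc] using h1
  have hpc1 : ∑ i, (p i : ℂ) = 1 := by exact_mod_cast congrArg (algebraMap ℝ ℂ) hp1
  have hchar := charpoly_sub_columns hPcp hpc1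
  rw [hPc, ← deflated_eq, ← hPc] at hchar
  have hroots : (deflated G p).charpoly.roots + {1} = Pc.charpoly.roots + {0} := by
    have h1 := congrArg Polynomial.roots hchar
    have hX : (Polynomial.X - 1 : Polynomial ℂ) = Polynomial.X - Polynomial.C 1 := by simp
    rwa [hX, Polynomial.roots_mul (mul_ne_zero (Matrix.charpoly_monic _).ne_zero
      (Polynomial.X_sub_C_ne_zero 1)), Polynomial.roots_mul
      (mul_ne_zero (Matrix.charpoly_monic _).ne_zero Polynomial.X_ne_zero),
      Polynomial.roots_X_sub_C, Polynomial.roots_X] at h1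
  have hmem : (1 : ℂ) ∈ Pc.charpoly.roots := by
    have h1 : (1 : ℂ) ∈ Pc.charpoly.roots + {0} := by rw [← hroots]; simp
    simpa using h1
  obtain ⟨R, hR⟩ := Multiset.exists_cons_of_mem hmem
  have hT : (deflated G p).charpoly.roots = 0 ::ₘ R := by
    rw [hR] at hroots
    have : (deflated G p).charpoly.roots + {1} = (0 ::ₘ R) + {1} := by
      rw [hroots, ← Multiset.singleton_add, ← Multiset.singleton_add 0 R]
      abel
    exact add_right_cancel this
  have hlt : ∀ c ∈ (deflated G p).charpoly.roots, ‖c‖ < 1 := fun c hc =>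
    norm_lt_one_of_mem_roots_deflated hG hn hp1 hc
  have hl : secondEigenvalue G = ((R.map fun z => ‖z‖).sort (· ≥ ·)).getD 0 0 := by
    rw [secondEigenvalue, eigenvalueModuli, ← hPc, hR, Multiset.map_cons, Multiset.sort_cons]
    · rfl
    · intro b hb
      obtain ⟨c, hc, rfl⟩ := Multiset.mem_map.1 hb
      simpa using (hlt c (by rw [hT]; exact Multiset.mem_cons_of_mem hc)).le
  obtain ⟨h1, h2⟩ := sort_getD_zero_spec (R.map fun z => ‖z‖)
  rw [← hl] at h1 h2
  have h3 : 0 ≤ secondEigenvalue G ∧ secondEigenvalue G < 1 := by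
    rcases h2 with h2 | h2
    · obtain ⟨c, hc, hc'⟩ := Multiset.mem_map.1 h2
      rw [← hc']
      exact ⟨norm_nonneg c, hlt c (by rw [hT]; exact Multiset.mem_cons_of_mem hc)⟩
    · rw [h2]; exact ⟨le_refl _, one_pos⟩
  refine ⟨h3.1, h3.2, fun c hc => ?_⟩
  rw [hT, Multiset.mem_cons] at hc
  rcases hc with rfl | hc
  · simpa using h3.1
  · exact h1 _ (Multiset.mem_map_of_mem _ hc)

lemma deflated_pow_apply (hG : StronglyConnected G) (hn : 2 ≤ n) {p : Fin n → ℝ}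
    (hp1 : ∑ i, p i = 1) (hp : (transition G).mulVec p = p) (t : ℕ) (i j : Fin n) :
    (deflated G p ^ (t + 1)) i j = (((transition G ^ (t + 1)) i j - p i : ℝ) : ℂ) := by
  have h1 : deflated G p ^ (t + 1) = ((transition G - columns p) ^ (t + 1)).map (algebraMap ℝ ℂ) :=
    (map_pow (algebraMap ℝ ℂ).mapMatrix _ _).symm
  rw [h1, sub_columns_pow hp hp1 (Matrix.sum_col_of_mem_colStochastic (transition_mem hG hn))]
  rfl

end SecondEigenvalue

/-! ### The weights and their limit -/

section Weights

variable {n : ℕ} (G : Digraph (Fin n))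

/-- The weights after `t` inner rounds. -/
def weights (w₀ : Fin n → ℝ) : ℕ → Fin n → ℝ
  | 0 => w₀
  | t + 1 => fun i => 1 / 2 * (weights w₀ t i + 1 / (outDegree G i : ℝ) *
      ∑ j ∈ inNeighbors G i, weights w₀ t j)

variable {G} {w₀ : Fin n → ℝ}

/-- Scaling by out-degrees turns the weight update into multiplication by `P`. -/
lemma degree_mul_weights (hG : StronglyConnected G) (hn : 2 ≤ n) (t : ℕ) :
    (fun i => outDegree G i * weights G w₀ t i) =
      (transition G ^ t).mulVec fun i => outDegree G i * w₀ i := by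
  induction t with
  | zero => simp [weights]
  | succ t ih =>
    rw [pow_succ', ← Matrix.mulVec_mulVec, ← ih]
    ext i
    have hd := (hG.outDegree_cast_pos hn i).ne'
    have h1 : ∀ j, transition G i j * (outDegree G j * weights G w₀ t j) =
        1 / 2 * ((1 : Matrix (Fin n) (Fin n) ℝ) i j * (outDegree G j * weights G w₀ t j)
          + adjacency G i j * weights G w₀ t j) := fun j => by
      have hdj := (hG.outDegree_cast_pos hn j).ne'
      rw [transition_apply hG hn]
      field_simp
    simp only [Matrix.mulVec, dotProduct, h1, ← Finset.mul_sum, Finset.sum_add_distrib,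
      sum_adjacency_mul, Matrix.one_apply, ite_mul, one_mul, zero_mul, Finset.sum_ite_eq,
      Finset.mem_univ, if_true, weights]
    field_simp

/-- The weights converge to positive weights which balance the graph, geometrically. -/
lemma exists_limit_weights (hG : StronglyConnected G) (hn : 2 ≤ n) (hw : ∀ i, 0 < w₀ i) :
    ∃ v : Fin n → ℝ, (∀ i, 0 < v i) ∧
      (∀ i, outDegree G i * v i = ∑ j ∈ inNeighbors G i, v j) ∧
      ∑ i, outDegree G i * v i = ∑ i, outDegree G i * w₀ i ∧
      0 ≤ secondEigenvalue G ∧ secondEigenvalue G < 1 ∧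
      ∃ C ≥ 0, ∃ t₀ : ℕ, ∀ t ≥ t₀, ∀ i,
        |outDegree G i * weights G w₀ t i - outDegree G i * v i| ≤ C * √(secondEigenvalue G) ^ t := by
  obtain ⟨N, hN⟩ := exists_isPrimitiveStochastic hG hn
  obtain ⟨p, hp0, hp1, hp⟩ := hN.exists_fixed (by omega)
  obtain ⟨hl0, hl1, hl⟩ := secondEigenvalue_spec hG hn hp1 hp
  have hd := hG.outDegree_cast_pos hn
  set W : Fin n → ℝ := fun i => outDegree G i * w₀ i with hW
  set S := ∑ i, W i with hS
  have hS0 : 0 < S := Finset.sum_pos (fun i _ => mul_pos (hd i) (hw i)) ⟨⟨0, by omega⟩, by simp⟩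
  have hdv : ∀ i, outDegree G i * (S * p i / outDegree G i) = S * p i := fun i => by
    have := (hd i).ne'
    field_simp
  -- The limit of `d_i w_i` is `S p_i`, since `P` preserves the total `S`; balance is `P p = p`
  -- rewritten.
  refine ⟨fun i => S * p i / outDegree G i, fun i => by have := hd i; have := hp0 i; positivity,
    fun i => ?_, ?_, hl0, hl1, ∑ j, |W j|, Finset.sum_nonneg fun _ _ => abs_nonneg _, ?_⟩
  · rw [← sum_adjacency_mul]
    have h1 : p i = ∑ j, transition G i j * p j := (congrFun hp i).symm
    have h2 : ∀ j, transition G i j * p j = 1 / 2 * ((1 : Matrix (Fin n) (Fin n) ℝ) i j * p j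
        + adjacency G i j * (p j / outDegree G j)) := fun j => by
      rw [transition_apply hG hn]; ring
    simp only [h2, ← Finset.mul_sum, Finset.sum_add_distrib, Matrix.one_apply, ite_mul, one_mul,
      zero_mul, Finset.sum_ite_eq, Finset.mem_univ, if_true] at h1
    have h3 : p i = ∑ j, adjacency G i j * (p j / outDegree G j) := by linarith
    rw [hdv, h3, Finset.mul_sum]
    exact Finset.sum_congr rfl fun j _ => by ring
  · simp only [hdv, ← Finset.mul_sum, hp1, mul_one]
  · obtain ⟨t₀, ht₀⟩ := norm_pow_entry_le hl0 hl1 hl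
    refine ⟨max t₀ 1, fun t ht i => ?_⟩
    obtain ⟨s, rfl⟩ : ∃ s, t = s + 1 := ⟨t - 1, by have := (le_max_right t₀ 1).trans ht; omega⟩
    have h1 : outDegree G i * weights G w₀ (s + 1) i = ∑ j, (transition G ^ (s + 1)) i j * W j :=
      congrFun (degree_mul_weights hG hn (s + 1)) i
    rw [hdv, h1, hS, Finset.sum_mul, ← Finset.sum_sub_distrib, Finset.sum_mul]
    refine (Finset.abs_sum_le_sum_abs _ _).trans (Finset.sum_le_sum fun j _ => ?_)
    have h2 := ht₀ (s + 1) ((le_max_left _ _).trans ht) i j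
    rw [deflated_pow_apply hG hn hp1 hp, Complex.norm_real, Real.norm_eq_abs] at h2
    rw [show (transition G ^ (s + 1)) i j * W j - W j * p i
      = W j * ((transition G ^ (s + 1)) i j - p i) by ring, abs_mul]
    exact mul_le_mul_of_nonneg_left h2 (abs_nonneg _)

lemma outDegree_le_max (i : Fin n) : outDegree G i ≤ maxOutDegree G :=
  Finset.le_sup (f := outDegree G) (Finset.mem_univ i)

lemma dist_le_diameter (i j : Fin n) : dist G i j ≤ diameter G :=
  (Finset.le_sup (f := fun j => dist G i j) (Finset.mem_univ j)).trans
    (Finset.le_sup (f := fun i => Finset.univ.sup fun j => dist G i j) (Finset.mem_univ i))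

lemma StronglyConnected.hasWalk_dist (hG : StronglyConnected G) (i j : Fin n) :
    HasWalk G (dist G i j) i j := Nat.sInf_mem (hG i j)

lemma StronglyConnected.diameter_pos (hG : StronglyConnected G) (hn : 2 ≤ n) :
    0 < diameter G := by
  have : Nontrivial (Fin n) := Fin.nontrivial_iff_two_le.2 hn
  obtain ⟨i, j, hij⟩ := exists_pair_ne (Fin n)
  refine lt_of_lt_of_le (Nat.pos_of_ne_zero fun h => ?_) (dist_le_diameter i j)
  have hw := hG.hasWalk_dist i j
  rw [h] at hw
  exact hij hw

/-- Balanced weights differ by at most a factor `d_max` along an edge. -/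
lemma balanced_le_of_walk {v : Fin n → ℝ} (hv : ∀ i, 0 < v i)
    (hbal : ∀ i, outDegree G i * v i = ∑ j ∈ inNeighbors G i, v j) {l : ℕ} {i j : Fin n}
    (h : HasWalk G l i j) : v i ≤ (maxOutDegree G : ℝ) ^ l * v j := by
  classical
  induction l generalizing i with
  | zero => obtain rfl : i = j := h; simp
  | succ l ih =>
    obtain ⟨m, him, hm⟩ := h
    have h1 : v i ≤ ∑ k ∈ inNeighbors G m, v k :=
      Finset.single_le_sum (f := v) (fun k _ => (hv k).le) (by simpa [inNeighbors] using him)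
    rw [← hbal] at h1
    have h2 : (outDegree G m : ℝ) ≤ maxOutDegree G := by exact_mod_cast outDegree_le_max m
    calc v i ≤ outDegree G m * v m := h1
      _ ≤ maxOutDegree G * ((maxOutDegree G : ℝ) ^ l * v j) :=
        mul_le_mul h2 (ih hm) (hv m).le (by positivity)
      _ = _ := by rw [pow_succ]; ring

/-- The limit weights stay below the inverse degrees. -/
lemma limit_weights_lt_one (hG : StronglyConnected G) (hn : 2 ≤ n) (hw : AdmissibleWeights G w₀)
    (hw1 : ∃ i, w₀ i < 1) {v : Fin n → ℝ} (hv : ∀ i, 0 < v i)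
    (hbal : ∀ i, outDegree G i * v i = ∑ j ∈ inNeighbors G i, v j)
    (hsum : ∑ i, outDegree G i * v i = ∑ i, outDegree G i * w₀ i) (i : Fin n) :
    outDegree G i * v i < 1 := by
  have hd := hG.outDegree_cast_pos hn
  set q := (maxOutDegree G : ℝ) with hq
  set φ := diameter G with hφ
  have hdq : ∀ j, (outDegree G j : ℝ) ≤ q := fun j => Nat.cast_le.2 (outDegree_le_max j)
  have hq1 : 1 ≤ q := by
    have h1 : 1 ≤ outDegree G i := hG.outDegree_pos hn i
    exact le_trans (by exact_mod_cast h1) (hdq i)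
  have hq0 : 0 < q := by linarith
  -- it suffices to compare with one small weight
  have key : ∀ j, q ^ (φ + 1) * v j < 1 → outDegree G i * v i < 1 := fun j hj => by
    have h1 := balanced_le_of_walk hv hbal (hG.hasWalk_dist i j)
    have h2 : q ^ dist G i j ≤ q ^ φ := pow_le_pow_right₀ hq1 (dist_le_diameter i j)
    calc outDegree G i * v i ≤ q * (q ^ φ * v j) :=
          mul_le_mul (hdq i) (h1.trans (mul_le_mul_of_nonneg_right h2 (hv j).le)) (hv i).le hq0.le
      _ = q ^ (φ + 1) * v j := by rw [pow_succ]; ring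
      _ < 1 := hj
  -- If `d_max = 1` all powers are `1`, and strictness must come from an initial weight below `1`.
  -- Otherwise it comes from `φ + 1 < 2φ + 1`.
  rcases eq_or_lt_of_le hq1 with h1 | h1
  · obtain ⟨k, hk⟩ := hw1
    have hlt : ∑ i, outDegree G i * v i < ∑ i, (outDegree G i : ℝ) := by
      rw [hsum]
      refine Finset.sum_lt_sum (fun j _ => ?_) ⟨k, Finset.mem_univ _, ?_⟩
      · have h2 := (hw j).2
        rw [← hq, ← h1, one_pow, inv_one] at h2
        exact mul_le_of_le_one_right (hd j).le h2
      · exact mul_lt_of_lt_one_right (hd k) hk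
    obtain ⟨j, -, hj⟩ := Finset.exists_lt_of_sum_lt hlt
    refine key j ?_
    rw [← h1, one_pow, one_mul]
    by_contra! h
    exact absurd hj (not_lt.2 (le_mul_of_one_le_right (hd j).le h))
  · obtain ⟨j, -, hj⟩ := Finset.exists_le_of_sum_le ⟨i, Finset.mem_univ i⟩ hsum.le
    have hj' : v j ≤ (q ^ (2 * φ + 1))⁻¹ := (le_of_mul_le_mul_left hj (hd j)).trans (hw j).2
    refine key j (lt_of_le_of_lt (mul_le_mul_of_nonneg_left hj' (by positivity)) ?_)
    rw [← div_eq_mul_inv, div_lt_one (by positivity)]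
    have := hG.diameter_pos hn
    exact pow_lt_pow_right₀ h1 (by omega)

end Weights

/-! ### Contraction of doubly stochastic matrices on vectors with zero sum -/

section Contraction

open scoped Matrix.Norms.L2Operator

variable {n : ℕ}

/-- Compactness of the unit sphere: the supremum of `‖A x‖` is attained there. -/
lemma opNorm_lt_one_of_forall {E : Type*} [NormedAddCommGroup E] [NormedSpace ℝ E]
    [FiniteDimensional ℝ E] (A : E →L[ℝ] E) (hA : ∀ x ≠ 0, ‖A x‖ < ‖x‖) : ‖A‖ < 1 := by
  have := FiniteDimensional.proper_real E
  rcases (Metric.sphere (0 : E) 1).eq_empty_or_nonempty with h | h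
  · refine lt_of_le_of_lt (A.opNorm_le_of_unit_norm le_rfl fun x hx => ?_) one_pos
    exact absurd (mem_sphere_zero_iff_norm.2 hx) (by simp [h])
  · obtain ⟨x₀, hx₀, hmax⟩ := (isCompact_sphere (0 : E) 1).exists_isMaxOn h
      (f := fun x => ‖A x‖) (by fun_prop)
    rw [mem_sphere_zero_iff_norm] at hx₀
    refine lt_of_le_of_lt (A.opNorm_le_of_unit_norm (norm_nonneg (A x₀)) fun x hx =>
      hmax (mem_sphere_zero_iff_norm.2 hx)) ?_
    rw [← hx₀]
    exact hA x₀ (by rw [← norm_pos_iff, hx₀]; exact one_pos)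

/-- The projection onto vectors with zero sum. -/
def centering (n : ℕ) : Matrix (Fin n) (Fin n) ℝ := 1 - columns fun _ => (n : ℝ)⁻¹

lemma centering_mulVec (v : Fin n → ℝ) (i : Fin n) :
    (centering n).mulVec v i = v i - (∑ j, v j) * (n : ℝ)⁻¹ := by
  rw [centering, Matrix.sub_mulVec, Matrix.one_mulVec, columns_mulVec]
  rfl

lemma sum_centering_mulVec (hn : n ≠ 0) (v : Fin n → ℝ) :
    ∑ i, (centering n).mulVec v i = 0 := by
  have : (n : ℝ) ≠ 0 := by exact_mod_cast hn
  simp only [centering_mulVec, Finset.sum_sub_distrib, Finset.sum_const, Finset.card_univ,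
    Fintype.card_fin, nsmul_eq_mul]
  field_simp
  ring

lemma sum_sq_centering_le (hn : n ≠ 0) (v : Fin n → ℝ) :
    ∑ i, (centering n).mulVec v i ^ 2 ≤ ∑ i, v i ^ 2 := by
  have hn' : (0 : ℝ) < n := by exact_mod_cast Nat.pos_of_ne_zero hn
  set S := ∑ j, v j with hS
  have h1 : ∑ i, (centering n).mulVec v i ^ 2 = ∑ i, v i ^ 2 - S ^ 2 * (n : ℝ)⁻¹ := by
    have h2 : ∀ i, (centering n).mulVec v i ^ 2
        = v i ^ 2 - 2 * (S * (n : ℝ)⁻¹) * v i + (S * (n : ℝ)⁻¹) ^ 2 := fun i => by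
      rw [centering_mulVec]; ring
    simp only [h2, Finset.sum_add_distrib, Finset.sum_sub_distrib, ← Finset.mul_sum, ← hS,
      Finset.sum_const, Finset.card_univ, Fintype.card_fin, nsmul_eq_mul]
    field_simp
    ring
  rw [h1]
  have : 0 ≤ S ^ 2 * (n : ℝ)⁻¹ := by positivity
  linarith

variable {G : Digraph (Fin n)}

/-- Matrices of averaging rounds which preserve averages and constants. -/
structure IsAveraging (G : Digraph (Fin n)) (Q : Matrix (Fin n) (Fin n) ℝ) : Prop where
  nonneg : ∀ i j, 0 ≤ Q i j
  diag_pos : ∀ i, 0 < Q i i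
  adj_pos : ∀ i j, G.Adj j i → 0 < Q i j
  sum_row : ∀ i, ∑ j, Q i j = 1
  sum_col : ∀ j, ∑ i, Q i j = 1

/-- Double stochasticity gives the variance identity `∑ Q_ij (v_j - (Qv)_i)² = ‖v‖² - ‖Qv‖²`. If the
loss vanished, positive entries on the diagonal and the edges would make `v` constant along edges,
hence constant, hence zero. -/
lemma IsAveraging.sum_sq_lt {Q : Matrix (Fin n) (Fin n) ℝ} (hQ : IsAveraging G Q)
    (hG : StronglyConnected G) {v : Fin n → ℝ} (hv : v ≠ 0) (hsum : ∑ i, v i = 0) :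
    ∑ i, Q.mulVec v i ^ 2 < ∑ i, v i ^ 2 := by
  have hid : ∑ i, ∑ j, Q i j * (v j - Q.mulVec v i) ^ 2
      = ∑ i, v i ^ 2 - ∑ i, Q.mulVec v i ^ 2 := by
    have h1 : ∀ i, ∑ j, Q i j * (v j - Q.mulVec v i) ^ 2
        = ∑ j, Q i j * v j ^ 2 - Q.mulVec v i ^ 2 := fun i => by
      have h2 : ∀ j, Q i j * (v j - Q.mulVec v i) ^ 2
          = Q i j * v j ^ 2 - 2 * Q.mulVec v i * (Q i j * v j) + Q i j * Q.mulVec v i ^ 2 :=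
        fun j => by ring
      have h3 : ∑ j, Q i j * v j = Q.mulVec v i := rfl
      simp only [h2, Finset.sum_add_distrib, Finset.sum_sub_distrib, ← Finset.mul_sum,
        ← Finset.sum_mul, hQ.sum_row, h3]
      ring
    simp only [h1, Finset.sum_sub_distrib]
    rw [Finset.sum_comm]
    simp only [← Finset.sum_mul, hQ.sum_col, one_mul]
  have hterm : ∀ i j, 0 ≤ Q i j * (v j - Q.mulVec v i) ^ 2 := fun i j =>
    mul_nonneg (hQ.nonneg i j) (sq_nonneg _)
  by_contra! hle
  have h0 : ∑ i, ∑ j, Q i j * (v j - Q.mulVec v i) ^ 2 = 0 :=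
    le_antisymm (by rw [hid]; linarith)
      (Finset.sum_nonneg fun i _ => Finset.sum_nonneg fun j _ => hterm i j)
  have heq : ∀ i j, 0 < Q i j → v j = Q.mulVec v i := fun i j hij => by
    have h1 := (Finset.sum_eq_zero_iff_of_nonneg fun i _ =>
      Finset.sum_nonneg fun j _ => hterm i j).1 h0 i (Finset.mem_univ i)
    have h2 := (Finset.sum_eq_zero_iff_of_nonneg fun j _ => hterm i j).1 h1 j (Finset.mem_univ j)
    have h3 := (mul_eq_zero.1 h2).resolve_left hij.ne'
    exact sub_eq_zero.1 (pow_eq_zero_iff two_ne_zero |>.1 h3)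
  have hwalk : ∀ l i j, HasWalk G l i j → v i = v j := by
    intro l
    induction l with
    | zero => rintro i j rfl; rfl
    | succ l ih =>
      rintro i j ⟨m, him, hm⟩
      rw [← ih m j hm, heq m i (hQ.adj_pos m i him), ← heq m m (hQ.diag_pos m)]
  refine hv (funext fun i => ?_)
  have h1 : ∀ j, v j = v i := fun j => let ⟨l, hl⟩ := hG j i; hwalk l j i hl
  simp only [h1, Finset.sum_const, Finset.card_univ, Fintype.card_fin, nsmul_eq_mul] at hsum
  have hn : (n : ℝ) ≠ 0 := by
    have : n ≠ 0 := fun h => (h ▸ i).elim0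
    exact_mod_cast this
  exact (mul_eq_zero.1 hsum).resolve_left hn

lemma IsAveraging.norm_mul_centering_lt_one {Q : Matrix (Fin n) (Fin n) ℝ} (hQ : IsAveraging G Q)
    (hG : StronglyConnected G) (hn : n ≠ 0) : ‖Q * centering n‖ < 1 := by
  rw [← Matrix.l2_opNorm_toEuclideanCLM]
  refine opNorm_lt_one_of_forall _ fun x hx => ?_
  rw [← sq_lt_sq₀ (norm_nonneg _) (norm_nonneg _), EuclideanSpace.norm_sq_eq,
    EuclideanSpace.norm_sq_eq, Matrix.ofLp_toEuclideanCLM]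
  simp only [Real.norm_eq_abs, sq_abs, ← Matrix.mulVec_mulVec]
  by_cases h : (centering n).mulVec x.ofLp = 0
  · rw [h, Matrix.mulVec_zero]
    have := norm_pos_iff.2 hx
    have h1 := EuclideanSpace.norm_sq_eq x
    simp only [Real.norm_eq_abs, sq_abs] at h1
    rw [← h1, Finset.sum_eq_zero fun i _ => by simp]
    positivity
  · exact (hQ.sum_sq_lt hG h (sum_centering_mulVec hn _)).trans_le (sum_sq_centering_le hn _)

end Contraction

/-! ### One averaging round -/

section Rounds

open scoped Matrix.Norms.L2Operator

variable {n d : ℕ}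

/-- The action of a matrix on local vectors. -/
def act (M : Matrix (Fin n) (Fin n) ℝ) (v : Fin n → Vec d) : Fin n → Vec d :=
  fun i => ∑ j, M i j • v j

/-- The matrix acts on each coordinate separately, so its operator norm serves for every dimension
`d`. This is why `δ` can be independent of `d`. -/
lemma norm_act_le (M : Matrix (Fin n) (Fin n) ℝ) (v : Fin n → Vec d) :
    ‖stack (act M v)‖ ≤ ‖M‖ * ‖stack v‖ := by
  refine (sq_le_sq₀ (norm_nonneg _) (by positivity)).1 ?_
  rw [mul_pow, norm_stack_sq, norm_stack_sq, sqNorm, sqNorm]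
  simp only [EuclideanSpace.norm_sq_eq, Real.norm_eq_abs, sq_abs]
  rw [Finset.sum_comm, Finset.sum_comm (s := Finset.univ (α := Fin n)), Finset.mul_sum]
  refine Finset.sum_le_sum fun c _ => ?_
  have h := Matrix.l2_opNorm_mulVec M (WithLp.toLp 2 fun j => v j c)
  have h2 := pow_le_pow_left₀ (norm_nonneg _) h 2
  rw [mul_pow, EuclideanSpace.norm_sq_eq, EuclideanSpace.norm_sq_eq] at h2
  simpa [act, Matrix.mulVec, dotProduct] using h2

lemma act_centering (v : Fin n → Vec d) : act (centering n) v = perp v := by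
  ext1 i
  simp [act, centering, perp, columns, sub_smul, Finset.sum_sub_distrib, Matrix.one_apply,
    ← Finset.smul_sum]

lemma act_mul (M N : Matrix (Fin n) (Fin n) ℝ) (v : Fin n → Vec d) :
    act (M * N) v = act M (act N v) := by
  ext1 i
  simp only [act, Matrix.mul_apply, Finset.sum_smul, Finset.smul_sum, smul_smul]
  exact Finset.sum_comm

variable (G : Digraph (Fin n))

/-- The matrix of one averaging round with weights `w`. -/
def mixing (w : Fin n → ℝ) : Matrix (Fin n) (Fin n) ℝ :=
  Matrix.of fun i j => (1 : Matrix (Fin n) (Fin n) ℝ) i j * (1 - outDegree G i * w i)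
    + adjacency G i j * w j

lemma innerStep_snd (s : (Fin n → ℝ) × (Fin n → Vec d)) :
    (innerStep G s).2 = act (mixing G s.1) s.2 := by
  classical
  ext1 i
  simp [innerStep, act, mixing, add_smul, Finset.sum_add_distrib, Matrix.one_apply, adjacency,
    inNeighbors, Finset.sum_filter, ite_smul, ite_mul]

lemma sum_row_mixing (w : Fin n → ℝ) (i : Fin n) :
    ∑ j, mixing G w i j = 1 - outDegree G i * w i + ∑ j ∈ inNeighbors G i, w j := by
  simp only [mixing, Matrix.of_apply, Finset.sum_add_distrib, sum_adjacency_mul, Matrix.one_apply]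
  simp

lemma sum_col_mixing (w : Fin n → ℝ) (j : Fin n) : ∑ i, mixing G w i j = 1 := by
  simp only [mixing, Matrix.of_apply, Finset.sum_add_distrib, ← Finset.sum_mul, sum_adjacency,
    Matrix.one_apply, ite_mul, one_mul, zero_mul, Finset.sum_ite_eq', Finset.mem_univ, if_true]
  ring

variable {G}

lemma isAveraging_mixing {v : Fin n → ℝ} (hv : ∀ i, 0 < v i)
    (hbal : ∀ i, outDegree G i * v i = ∑ j ∈ inNeighbors G i, v j)
    (hlt : ∀ i, outDegree G i * v i < 1) : IsAveraging G (mixing G v) where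
  nonneg i j := by
    have h1 := hlt i
    have h2 := adjacency_nonneg (G := G) i j
    have h3 := (hv j).le
    simp only [mixing, Matrix.of_apply, Matrix.one_apply]
    refine add_nonneg (mul_nonneg ?_ (by linarith)) (mul_nonneg h2 h3)
    split_ifs <;> norm_num
  diag_pos i := by
    have h1 := hlt i
    have h2 := adjacency_nonneg (G := G) i i
    have h3 := (hv i).le
    simp only [mixing, Matrix.of_apply, Matrix.one_apply_eq]
    exact add_pos_of_pos_of_nonneg (by linarith) (mul_nonneg h2 h3)
  adj_pos i j h := by
    have h1 := hlt i
    simp only [mixing, Matrix.of_apply, adjacency_eq_one h, one_mul, Matrix.one_apply]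
    refine add_pos_of_nonneg_of_pos (mul_nonneg ?_ (by linarith)) (hv j)
    split_ifs <;> norm_num
  sum_row i := by rw [sum_row_mixing, hbal]; ring
  sum_col := sum_col_mixing G v

/-- The average of the local vectors. -/
def mean (v : Fin n → Vec d) : Vec d := (1 / (n : ℝ)) • ∑ j, v j

lemma card_mul_norm_mean_sq_le (hn : n ≠ 0) (v : Fin n → Vec d) :
    n * ‖mean v‖ ^ 2 ≤ sqNorm v := by
  have hn' : (0 : ℝ) < n := by exact_mod_cast Nat.pos_of_ne_zero hn
  have h1 : ‖∑ j, v j‖ ^ 2 ≤ n * sqNorm v := by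
    refine (pow_le_pow_left₀ (norm_nonneg _) (norm_sum_le _ _) 2).trans ?_
    simpa [sqNorm] using sq_sum_le_card_mul_sum_sq (s := Finset.univ) (f := fun j => ‖v j‖)
  have h2 : n * ‖mean v‖ ^ 2 = ‖∑ j, v j‖ ^ 2 / n := by
    rw [mean, norm_smul, mul_pow, Real.norm_of_nonneg (by positivity)]
    field_simp
  rw [h2, div_le_iff₀ hn']
  linarith

/-- Column sums one preserve the mean, while the row-sum defects turn it into new disagreement: that
is the term `e * r`. -/
lemma norm_perp_act_mixing_le (hn : n ≠ 0) (w : Fin n → ℝ) {e : ℝ} (he : 0 ≤ e)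
    (hrow : ∀ i, |∑ j, mixing G w i j - 1| ≤ e) (v : Fin n → Vec d) {r : ℝ} (hr : 0 ≤ r)
    (hmean : n * ‖mean v‖ ^ 2 ≤ r ^ 2) :
    ‖stack (perp (act (mixing G w) v))‖ ≤
      ‖mixing G w * centering n‖ * ‖stack (perp v)‖ + e * r := by
  have hsum : ∑ i, act (mixing G w) v i = ∑ i, v i := by
    simp only [act]
    rw [Finset.sum_comm]
    simp only [← Finset.sum_smul, sum_col_mixing, one_smul]
  have hperp : ∑ i, perp v i = 0 := sum_perp hn v
  have hdec : perp (act (mixing G w) v) = act (mixing G w * centering n) (perp v)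
      + fun i => (∑ j, mixing G w i j - 1) • mean v := by
    ext1 i
    rw [act_mul, act_centering, perp_eq_self hperp, Pi.add_apply, perp, hsum]
    simp only [act, perp, smul_sub, Finset.sum_sub_distrib, ← Finset.sum_smul, sub_smul, one_smul,
      mean]
    abel
  rw [hdec]
  refine (norm_add_le (stack _) (stack _)).trans (add_le_add (norm_act_le _ _) ?_)
  refine (sq_le_sq₀ (norm_nonneg _) (by positivity)).1 ?_
  rw [mul_pow, norm_stack_sq]
  calc sqNorm (fun i => (∑ j, mixing G w i j - 1) • mean v)
      ≤ ∑ _i : Fin n, e ^ 2 * ‖mean v‖ ^ 2 := by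
        refine Finset.sum_le_sum fun i _ => ?_
        rw [norm_smul, mul_pow, Real.norm_eq_abs]
        exact mul_le_mul_of_nonneg_right (pow_le_pow_left₀ (abs_nonneg _) (hrow i) 2)
          (sq_nonneg _)
    _ = e ^ 2 * (n * ‖mean v‖ ^ 2) := by simp; ring
    _ ≤ e ^ 2 * r ^ 2 := mul_le_mul_of_nonneg_left hmean (sq_nonneg e)

end Rounds

/-! ### The consensus constant -/

section Consensus

open scoped Matrix.Norms.L2Operator

variable {n d : ℕ} {G : Digraph (Fin n)} {w₀ : Fin n → ℝ}

/-- The failure of double stochasticity is an increment of the scaled weights, so it decays as fast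
as they converge. -/
lemma mixing_row_sum_sub_one (hG : StronglyConnected G) (hn : 2 ≤ n) (t : ℕ) (i : Fin n) :
    ∑ j, mixing G (weights G w₀ t) i j - 1 =
      2 * (outDegree G i * weights G w₀ (t + 1) i - outDegree G i * weights G w₀ t i) := by
  have := (hG.outDegree_cast_pos hn i).ne'
  rw [sum_row_mixing, weights]
  field_simp
  ring

/-- Eventually every averaging round contracts disagreement, up to errors which decay like
`√λ₂ ^ t`. -/
lemma exists_round_contraction (hG : StronglyConnected G) (hn : 2 ≤ n)
    (hw : AdmissibleWeights G w₀) (hw1 : ∃ i, w₀ i < 1) :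
    0 ≤ secondEigenvalue G ∧ secondEigenvalue G < 1 ∧
      ∃ δ : ℝ, 0 < δ ∧ δ < 1 ∧ ∃ C ≥ 0, ∃ t₀ : ℕ, ∀ t ≥ t₀,
        ‖mixing G (weights G w₀ t) * centering n‖ ≤ δ ∧
        ∀ i, |∑ j, mixing G (weights G w₀ t) i j - 1| ≤ C * √(secondEigenvalue G) ^ t := by
  obtain ⟨v, hv, hbal, hsum, hl0, hl1, C, hC, t₀, ht₀⟩ :=
    exists_limit_weights hG hn fun i => (hw i).1
  refine ⟨hl0, hl1, ?_⟩
  have hlt := limit_weights_lt_one hG hn hw hw1 hv hbal hsum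
  have hnorm := (isAveraging_mixing hv hbal hlt).norm_mul_centering_lt_one hG (by omega : n ≠ 0)
  set q := √(secondEigenvalue G) with hq
  have hq0 : 0 ≤ q := Real.sqrt_nonneg _
  have hq1 : q < 1 := by rw [hq, Real.sqrt_lt' one_pos]; simpa using hl1
  have htend : ∀ i, Filter.Tendsto (fun t => weights G w₀ t i) Filter.atTop (nhds (v i)) := by
    intro i
    have hd := hG.outDegree_cast_pos hn i
    have h1 : Filter.Tendsto (fun t => outDegree G i * weights G w₀ t i) Filter.atTop
        (nhds (outDegree G i * v i)) := by
      rw [tendsto_iff_norm_sub_tendsto_zero]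
      refine squeeze_zero' (Filter.Eventually.of_forall fun _ => norm_nonneg _)
        (Filter.eventually_atTop.2 ⟨t₀, fun t ht => ht₀ t ht i⟩) ?_
      simpa using (tendsto_pow_atTop_nhds_zero_of_lt_one hq0 hq1).const_mul C
    have h2 := h1.const_mul (outDegree G i : ℝ)⁻¹
    simpa [hd.ne'] using h2
  have hQ : Filter.Tendsto (fun t => mixing G (weights G w₀ t)) Filter.atTop
      (nhds (mixing G v)) := by
    refine tendsto_pi_nhds.2 fun i => tendsto_pi_nhds.2 fun j => ?_
    exact ((tendsto_const_nhds.sub ((htend i).const_mul _)).const_mul _).add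
      ((htend j).const_mul _)
  have hQJ := (hQ.mul_const (centering n)).norm
  obtain ⟨δ, hδ, hδ1⟩ := exists_between hnorm
  obtain ⟨t₁, ht₁⟩ := Filter.eventually_atTop.1 (hQJ.eventually_le_const hδ)
  -- In `4 * C` one factor two is from the row-sum identity, the other from bounding an increment by
  -- two distances to the limit.
  refine ⟨δ, (norm_nonneg _).trans_lt hδ, hδ1, 4 * C, by positivity, max t₀ t₁, fun t ht =>
    ⟨ht₁ t ((le_max_right _ _).trans ht), fun i => ?_⟩⟩
  have ht0 := (le_max_left _ _).trans ht
  have h1 := ht₀ t ht0 i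
  have h2 := ht₀ (t + 1) (ht0.trans (Nat.le_succ t)) i
  have h3 : C * q ^ (t + 1) ≤ C * q ^ t :=
    mul_le_mul_of_nonneg_left (pow_le_pow_of_le_one hq0 hq1.le (Nat.le_succ t)) hC
  rw [mixing_row_sum_sub_one hG hn]
  rw [abs_le] at h1 h2 ⊢
  constructor <;> linarith [h1.1, h1.2, h2.1, h2.2]

lemma innerStep_iterate_fst (t b : ℕ) (ξ : Fin n → Vec d) :
    ((innerStep G)^[b] (weights G w₀ t, ξ)).1 = weights G w₀ (t + b) := by
  induction b with
  | zero => rfl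
  | succ b ih =>
    rw [Function.iterate_succ_apply']
    simp only [innerStep, ih]
    rfl

lemma iterates_w (f : Fin n → Vec d → ℝ) (η ρ : ℝ) (B k : ℕ) :
    (iterates G w₀ f η ρ B k).w = weights G w₀ (k * B) := by
  induction k with
  | zero => rw [zero_mul]; rfl
  | succ k ih =>
    rw [Nat.succ_mul, ← innerStep_iterate_fst (k * B) B
      (gradientStep f η ρ (iterates G w₀ f η ρ B k)), ← ih]
    rfl

/-- The disagreement after `b` rounds of averaging. -/
lemma norm_perp_innerStep_iterate_le (hn : n ≠ 0) {δ e : ℝ} (hδ0 : 0 ≤ δ) (hδ1 : δ ≤ 1)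
    (he : 0 ≤ e) {T : ℕ}
    (hδ : ∀ t ≥ T, ‖mixing G (weights G w₀ t) * centering n‖ ≤ δ)
    (hrow : ∀ t ≥ T, ∀ i, |∑ j, mixing G (weights G w₀ t) i j - 1| ≤ e)
    (ξ : Fin n → Vec d) (b : ℕ) :
    ‖stack (perp ((innerStep G)^[b] (weights G w₀ T, ξ)).2)‖ ≤
      δ ^ b * ‖stack (perp ξ)‖ + b * (e * ‖stack ξ‖) := by
  induction b with
  | zero => simp
  | succ b ih =>
    have hmean : n * ‖mean ((innerStep G)^[b] (weights G w₀ T, ξ)).2‖ ^ 2 ≤ ‖stack ξ‖ ^ 2 := by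
      rw [mean, sum_innerStep_iterate, norm_stack_sq]
      exact card_mul_norm_mean_sq_le hn ξ
    have hT : T + b ≥ T := Nat.le_add_right T b
    rw [Function.iterate_succ_apply', innerStep_snd, innerStep_iterate_fst]
    refine (norm_perp_act_mixing_le hn _ he (hrow _ hT) _ (norm_nonneg _) hmean).trans ?_
    have h1 := mul_le_mul_of_nonneg_right (hδ _ hT)
      (norm_nonneg (stack (perp ((innerStep G)^[b] (weights G w₀ T, ξ)).2)))
    have h2 := mul_le_mul_of_nonneg_left ih hδ0
    have h3 : 0 ≤ b * (e * ‖stack ξ‖) := by positivity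
    have h4 := mul_le_of_le_one_left h3 hδ1
    rw [pow_succ]
    push_cast
    linarith

/-- Young's inequality with weights `δ` and `1 - δ`. Dividing `δ^(2B)` by `δ` is the source of the
exponent `2B - 1`. -/
lemma sq_add_le_div {a b δ : ℝ} (hδ0 : 0 < δ) (hδ1 : δ < 1) :
    (a + b) ^ 2 ≤ a ^ 2 / δ + b ^ 2 / (1 - δ) := by
  have h : 0 < 1 - δ := by linarith
  rw [div_add_div _ _ hδ0.ne' h.ne', le_div_iff₀ (by positivity)]
  nlinarith [sq_nonneg (a * (1 - δ) - b * δ)]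

lemma sqNorm_le_two (x x' : Fin n → Vec d) :
    sqNorm x ≤ 2 * (sqNorm (x - x') + sqNorm x') := by
  have h := norm_add_sq_le_two (stack (x - x')) (stack x')
  rw [← WithLp.toLp_add, sub_add_cancel, norm_stack_sq, norm_stack_sq, norm_stack_sq] at h
  linarith

theorem exists_consensusConstant (hG : StronglyConnected G) (hn : 2 ≤ n)
    (hw : AdmissibleWeights G w₀) (hw1 : ∃ i, w₀ i < 1) :
    ∃ δ : ℝ, 0 < δ ∧ δ < 1 ∧ ∀ (d : ℕ) (f : Fin n → Vec d → ℝ) (u : Vec d) (η ρ : ℝ) (B : ℕ),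
      1 ≤ B → IsConsensusConstant G w₀ f η ρ B u δ := by
  obtain ⟨hl0, hl1, δ, hδ0, hδ1, C, hC, t₀, ht₀⟩ := exists_round_contraction hG hn hw hw1
  refine ⟨δ, hδ0, hδ1, fun d f u η ρ B hB => ?_⟩
  set l := secondEigenvalue G with hl
  have hq0 : 0 ≤ √l := Real.sqrt_nonneg _
  have hq1 : √l ≤ 1 := Real.sqrt_le_one.2 hl1.le
  have hδ' : 0 < 1 - δ := by linarith
  -- The factor two pays for `‖x‖² ≤ 2(‖x - x⋆‖² + ‖x⋆‖²)`.
  set A := 2 * (B * C) ^ 2 / (1 - δ) with hA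
  have hA0 : 0 ≤ A := by positivity
  -- The rounds producing `z^k` start at time `(k-1)B ≥ k-1`, hence the shifted exponent. Squaring
  -- has turned `√l` into `l`.
  refine ⟨t₀ + 1, Nat.succ_pos _, fun k => A * l ^ (k - 1), ?_, fun k hk => ?_⟩
  · rcases hl0.eq_or_lt with h0 | h0
    · refine Asymptotics.IsBigO.of_bound 1 ?_
      filter_upwards [Filter.eventually_ge_atTop 2] with k hk
      rw [← h0, zero_pow (by omega), mul_zero, norm_zero]
      positivity
    · refine Asymptotics.IsBigO.of_bound (A / l) ?_
      filter_upwards [Filter.eventually_ge_atTop 1] with k hk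
      obtain ⟨j, rfl⟩ : ∃ j, k = j + 1 := ⟨k - 1, by omega⟩
      rw [Real.norm_of_nonneg (by positivity), Real.norm_of_nonneg (by positivity),
        Nat.add_sub_cancel, pow_succ]
      refine le_of_eq ?_
      rw [← hl]
      field_simp
  · obtain ⟨K, rfl⟩ : ∃ K, k = K + 1 := ⟨k - 1, by omega⟩
    have hK : t₀ ≤ K := by omega
    have hKB : K ≤ K * B := Nat.le_mul_of_pos_right K hB
    set x := (iterates G w₀ f η ρ B (K + 1)).x with hx
    have hz : (iterates G w₀ f η ρ B (K + 1)).z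
        = ((innerStep G)^[B] (weights G w₀ (K * B), x)).2 := by
      rw [← iterates_w f η ρ B K]; rfl
    have h1 := norm_perp_innerStep_iterate_le (T := K * B) (by omega : n ≠ 0) hδ0.le hδ1.le
      (mul_nonneg hC (pow_nonneg hq0 K))
      (fun t ht => (ht₀ t (hK.trans (hKB.trans ht))).1)
      (fun t ht i => ((ht₀ t (hK.trans (hKB.trans ht))).2 i).trans
        (mul_le_mul_of_nonneg_left (pow_le_pow_of_le_one hq0 hq1 (hKB.trans ht)) hC)) x B
    rw [← hz] at h1
    have h2 := (pow_le_pow_left₀ (norm_nonneg _) h1 2).trans (sq_add_le_div hδ0 hδ1)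
    have e1 : (δ ^ B * ‖stack (perp x)‖) ^ 2 / δ = δ ^ (2 * B - 1) * sqNorm (perp x) := by
      obtain ⟨b, rfl⟩ : ∃ b, B = b + 1 := ⟨B - 1, by omega⟩
      rw [mul_pow, norm_stack_sq, ← pow_mul, show (b + 1) * 2 = (2 * (b + 1) - 1) + 1 by omega,
        pow_succ]
      field_simp
    have e2 : (B * (C * √l ^ K * ‖stack x‖)) ^ 2 / (1 - δ) = A / 2 * l ^ K * sqNorm x := by
      have e3 : l ^ K = (√l ^ K) ^ 2 := by rw [← pow_mul, mul_comm, pow_mul, Real.sq_sqrt hl0]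
      rw [hA, ← norm_stack_sq, e3]
      field_simp
    rw [e1, e2, norm_stack_sq] at h2
    refine h2.trans (add_le_add_right ?_ _)
    beta_reduce
    rw [show K + 1 - 1 = K from rfl]
    have h3 := mul_le_mul_of_nonneg_left (sqNorm_le_two x (primalOpt n u))
      (by positivity : 0 ≤ A / 2 * l ^ K)
    linarith

end Consensus

end

end IPD

theorem corollary1 :
    ∃ c : ℝ, 0 < c ∧ c < 1 ∧
      ∀ (n : ℕ) (_ : 2 ≤ n) (G : Digraph (Fin n)) (_ : IPD.StronglyConnected G)
        (w₀ : Fin n → ℝ) (_ : IPD.AdmissibleWeights G w₀) (_ : ∃ i, w₀ i < 1),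
        (∃ δ : ℝ, 0 < δ ∧ δ < 1 ∧
          ∀ (d : ℕ) (f : Fin n → IPD.Vec d → ℝ) (_ : ∀ i, Differentiable ℝ (f i))
            (u : IPD.Vec d) (_ : IPD.IsMinimizer f u)
            (η ρ : ℝ) (_ : 0 < η) (_ : 0 < ρ) (B : ℕ) (_ : 1 ≤ B),
            IPD.IsConsensusConstant G w₀ f η ρ B u δ) ∧
        ∀ (d : ℕ) (f : Fin n → IPD.Vec d → ℝ) (m_f M_f : ℝ)
          (_ : IPD.RegularObjectives f m_f M_f)
          (u : IPD.Vec d) (_ : IPD.IsMinimizer f u)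
          (κ η ρ : ℝ) (_ : κ = M_f / m_f)
          (_ : η = 4 / (15 * (M_f + m_f)))
          (_ : ρ = 2 / 87 * (M_f * m_f / (M_f + m_f)))
          (δ : ℝ) (_ : 0 < δ) (_ : δ < 1) (B : ℕ)
          (_ : IPD.IsConsensusConstant G w₀ f η ρ B u δ)
          (_ : (B : ℝ) > 1 / 2 + Real.log (1000 * (κ + 1)) / (2 * Real.log (1 / δ))),
          IPD.ConvergesLinearly (IPD.optError G w₀ f η ρ B u)
            (max (1 - c / κ) (IPD.secondEigenvalue G)) := by
  -- The Lyapunov contraction permits any constant below `1/2000`, because `M + m ≤ 2M`.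
  refine ⟨1 / 4000, by norm_num, by norm_num, fun n hn G hG w₀ hw hw1 => ⟨?_, ?_⟩⟩
  · obtain ⟨δ, hδ0, hδ1, h⟩ := IPD.exists_consensusConstant hG hn hw hw1
    exact ⟨δ, hδ0, hδ1, fun d f _ u _ η ρ _ _ B hB => h d f u η ρ B hB⟩
  · intro d f m M hf u hu κ η ρ hκ hη hρ δ hδ0 hδ1 B hc hB
    obtain ⟨hl0, hl1, -⟩ := IPD.exists_round_contraction hG hn hw hw1
    exact IPD.convergesLinearly_of_consensus (by omega) hl0 hl1 hf hu hκ hη hρ hδ0 hδ1 hc hB
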